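/- Let $A$ be an associative ring with unit and let $\mathcal C$ be an $A$-coring, that is, an $(A,A)$-bimodule with $(A,A)$-bimodule maps $\Delta:\mathcal C\to\mathcal C\otimes_A\mathcal C$, $\Delta(c)=\sum c_{(1)}\otimes c_{(2)}$, and $\varepsilon:\mathcal C\to A$ that are coassociative and counital. Let ${\mathcal C}^*=\operatorname{Hom}_{-A}(\mathcal C,A)$ (right $A$-linear maps) be the ring with product $(\xi\xi')(c)=\sum\xi(\xi'(c_{(1)})c_{(2)})$ and unit $\varepsilon$, and let ${}^*\mathcal C=\operatorname{Hom}_{A-}(\mathcal C,A)$ (left $A$-linear maps) be the ring with product $(\xi\xi')(c)=\sum\xi'(c_{(1)}\xi(c_{(2)}))$ and unit $\varepsilon$. Let $\iota^*:A\to\mathcal C^*$, $a\mapsto\varepsilon(a\,-)$, and ${}^*\iota:A\to{}^*\mathcal C$, $a\mapsto\varepsilon(-\,a)$, be the associated ring homomorphisms. Suppose that $\mathcal C$ is reflexive as a left and as a right $A$-module, i.e. the evaluation maps $$\mathcal C\to\operatorname{Hom}_{-A}(\operatorname{Hom}_{A-}(\mathcal C,A),A),\qquad \mathcal C\to\operatorname{Hom}_{A-}(\operatorname{Hom}_{-A}(\mathcal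 C,A),A)$$ are bijective. Then the following are equivalent: 1. $\mathcal C$ is a Frobenius coring, i.e. the forgetful functor from right $\mathcal C$-comodules to right $A$-modules is a Frobenius functor: there is a functor that is both a left and a right adjoint of it; 2. ${}^*\iota:A\to{}^*\mathcal C$ is a Frobenius extension; 3. $\iota^*:A\to\mathcal C^*$ is a Frobenius extension. Here a ring homomorphism $R\to S$ is called a Frobenius extension if $S$ is finitely generated projective as a right $R$-module and $S\cong\operatorname{Hom}_{-R}(S,R)$ as $(R,S)$-bimodules, where $(r\varphi s)(y)=r\,\varphi(sy)$. -/

import Mathlib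

open CategoryTheory MulOpposite

/-!  Right `A`-modules are modules over `Aᵐᵒᵖ`, with `m a = op a • m`; an `(A, A)`-bimodule is an
abelian group with commuting `A`- and `Aᵐᵒᵖ`-module structures.  Mathlib's tensor product needs a
commutative base ring, so the tensor product over a noncommutative ring is constructed first. -/

universe u v v₁ v₂ v₃ v₄

/-- The subgroup of `M ⊗_ℤ N` generated by the elements `m a ⊗ n - m ⊗ a n`. -/
def balancingSubgroup (A : Type u) (M : Type v₁) (N : Type v₂) [Ring A]
    [AddCommGroup M] [Module Aᵐᵒᵖ M] [AddCommGroup N] [Module A N] :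
    AddSubgroup (TensorProduct ℤ M N) :=
  AddSubgroup.closure
    {x | ∃ (m : M) (a : A) (n : N),
      x = TensorProduct.tmul ℤ (op a • m) n - TensorProduct.tmul ℤ m (a • n)}

/-- The tensor product `M ⊗_A N` of a right `A`-module `M` and a left `A`-module `N`. -/
def BTensor (A : Type u) (M : Type v₁) (N : Type v₂) [Ring A]
    [AddCommGroup M] [Module Aᵐᵒᵖ M] [AddCommGroup N] [Module A N] : Type (max v₁ v₂) :=
  TensorProduct ℤ M N ⧸ balancingSubgroup A M N

namespace BTensor

section Basic

variable (A : Type u) {M : Type v₁} {N : Type v₂} [Ring A]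
  [AddCommGroup M] [Module Aᵐᵒᵖ M] [AddCommGroup N] [Module A N]

instance instAddCommGroup : AddCommGroup (BTensor A M N) :=
  inferInstanceAs (AddCommGroup (TensorProduct ℤ M N ⧸ balancingSubgroup A M N))

/-- The pure tensor `m ⊗ n`. -/
def tmul (m : M) (n : N) : BTensor A M N :=
  QuotientAddGroup.mk' (balancingSubgroup A M N) (TensorProduct.tmul ℤ m n)

theorem add_tmul (m m' : M) (n : N) : tmul A (m + m') n = tmul A m n + tmul A m' n := by
  unfold tmul
  rw [TensorProduct.add_tmul, map_add]
  rfl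

theorem tmul_add (m : M) (n n' : N) : tmul A m (n + n') = tmul A m n + tmul A m n' := by
  unfold tmul
  rw [TensorProduct.tmul_add, map_add]
  rfl

theorem op_smul_tmul (m : M) (a : A) (n : N) : tmul A (op a • m) n = tmul A m (a • n) := by
  refine (QuotientAddGroup.eq_iff_sub_mem).2 ?_
  exact AddSubgroup.subset_closure ⟨m, a, n, rfl⟩

@[elab_as_elim]
theorem induction_on {p : BTensor A M N → Prop} (t : BTensor A M N)
    (h0 : p 0) (ht : ∀ m n, p (tmul A m n)) (ha : ∀ x y, p x → p y → p (x + y)) : p t := by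
  obtain ⟨x, rfl⟩ := QuotientAddGroup.mk'_surjective (balancingSubgroup A M N) t
  induction x using TensorProduct.induction_on with
  | zero => rw [map_zero]; exact h0
  | tmul m n => exact ht m n
  | add x y hx hy => rw [map_add]; exact ha _ _ hx hy

variable {A}

theorem hom_ext {P : Type v₃} [AddCommGroup P] {f g : BTensor A M N →+ P}
    (h : ∀ m n, f (tmul A m n) = g (tmul A m n)) : f = g := by
  ext t
  induction t using BTensor.induction_on with
  | h0 => rw [map_zero, map_zero]
  | ht m n => exact h m n
  | ha x y hx hy => rw [map_add, map_add, hx, hy]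

@[simp]
theorem zero_tmul (n : N) : tmul A (0 : M) n = 0 := by
  simpa using add_tmul A (0 : M) 0 n

@[simp]
theorem tmul_zero (m : M) : tmul A m (0 : N) = 0 := by
  simpa using tmul_add A m (0 : N) 0

/-- The additive map out of `M ⊗_A N` induced by an `A`-balanced biadditive map. -/
def lift {P : Type v₃} [AddCommGroup P] (f : M → N → P)
    (hl : ∀ m m' n, f (m + m') n = f m n + f m' n)
    (hr : ∀ m n n', f m (n + n') = f m n + f m n')
    (hf : ∀ (m : M) (a : A) (n : N), f (op a • m) n = f m (a • n)) : BTensor A M N →+ P :=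
  QuotientAddGroup.lift (balancingSubgroup A M N)
    (TensorProduct.liftAddHom
      (AddMonoidHom.mk' (fun m => AddMonoidHom.mk' (f m) (hr m))
        (fun m m' => AddMonoidHom.ext (hl m m')))
      (fun r m n => by rw [map_zsmul, map_zsmul]; rfl)) (by
      unfold balancingSubgroup
      rw [AddSubgroup.closure_le]
      rintro x ⟨m, a, n, rfl⟩
      change _ = _
      rw [map_sub, sub_eq_zero]
      exact hf m a n)

@[simp]
theorem lift_tmul {P : Type v₃} [AddCommGroup P] (f : M → N → P)
    (hl : ∀ m m' n, f (m + m') n = f m n + f m' n)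
    (hr : ∀ m n n', f m (n + n') = f m n + f m n')
    (hf : ∀ (m : M) (a : A) (n : N), f (op a • m) n = f m (a • n)) (m : M) (n : N) :
    lift f hl hr hf (tmul A m n) = f m n := rfl

/-- The map `f ⊗ g` induced by a right linear map `f` and a left linear map `g`. -/
def map {M' : Type v₃} {N' : Type v₄} [AddCommGroup M'] [Module Aᵐᵒᵖ M']
    [AddCommGroup N'] [Module A N'] (f : M →ₗ[Aᵐᵒᵖ] M') (g : N →ₗ[A] N') :
    BTensor A M N →+ BTensor A M' N' :=
  lift (fun m n => tmul A (f m) (g n))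
    (fun m m' n => by rw [map_add, add_tmul])
    (fun m n n' => by rw [map_add, tmul_add])
    (fun m a n => by rw [map_smul, map_smul, op_smul_tmul])

@[simp]
theorem map_tmul {M' : Type v₃} {N' : Type v₄} [AddCommGroup M'] [Module Aᵐᵒᵖ M']
    [AddCommGroup N'] [Module A N'] (f : M →ₗ[Aᵐᵒᵖ] M') (g : N →ₗ[A] N') (m : M) (n : N) :
    map f g (tmul A m n) = tmul A (f m) (g n) := rfl

end Basic

section Actions

variable {A : Type u} {M : Type v₁} {N : Type v₂} [Ring A]
  [AddCommGroup M] [Module Aᵐᵒᵖ M] [AddCommGroup N] [Module A N]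

/-- If `M` is a bimodule, then `M ⊗_A N` is a left `A`-module through `a (m ⊗ n) = a m ⊗ n`. -/
instance instLeftModule [Module A M] [SMulCommClass A Aᵐᵒᵖ M] : Module A (BTensor A M N) where
  smul a t := map (DistribSMul.toLinearMap Aᵐᵒᵖ M a) LinearMap.id t
  one_smul t := by
    refine DFunLike.congr_fun (f := map _ _) (g := AddMonoidHom.id _) (hom_ext fun m n => ?_) t
    simp
  mul_smul a b t := by
    refine DFunLike.congr_fun (f := map _ _) (g := (map _ _).comp (map _ _))
      (hom_ext fun m n => ?_) t
    simp [mul_smul]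
  smul_zero a := map_zero _
  smul_add a s t := map_add _ s t
  add_smul a b t := by
    refine DFunLike.congr_fun (f := map (DistribSMul.toLinearMap Aᵐᵒᵖ M (a + b)) LinearMap.id)
      (g := map (DistribSMul.toLinearMap Aᵐᵒᵖ M a) LinearMap.id +
        map (DistribSMul.toLinearMap Aᵐᵒᵖ M b) LinearMap.id) (hom_ext fun m n => ?_) t
    simp [add_smul, add_tmul]
  zero_smul t := by
    refine DFunLike.congr_fun (f := map _ _) (g := 0) (hom_ext fun m n => ?_) t
    simp

/-- If `N` is a bimodule, then `M ⊗_A N` is a right `A`-module through `(m ⊗ n) a = m ⊗ n a`. -/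
instance instRightModule [Module Aᵐᵒᵖ N] [SMulCommClass A Aᵐᵒᵖ N] :
    Module Aᵐᵒᵖ (BTensor A M N) :=
  letI : SMulCommClass Aᵐᵒᵖ A N := SMulCommClass.symm A Aᵐᵒᵖ N
  { smul := fun a t => map LinearMap.id (DistribSMul.toLinearMap A N a) t
    one_smul := fun t => by
      refine DFunLike.congr_fun (f := map _ _) (g := AddMonoidHom.id _)
        (hom_ext fun m n => ?_) t
      simp
    mul_smul := fun a b t => by
      refine DFunLike.congr_fun (f := map _ _) (g := (map _ _).comp (map _ _))
        (hom_ext fun m n => ?_) t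
      simp [mul_smul]
    smul_zero := fun a => map_zero _
    smul_add := fun a s t => map_add _ s t
    add_smul := fun a b t => by
      refine DFunLike.congr_fun (f := map LinearMap.id (DistribSMul.toLinearMap A N (a + b)))
        (g := map LinearMap.id (DistribSMul.toLinearMap A N a) +
          map LinearMap.id (DistribSMul.toLinearMap A N b)) (hom_ext fun m n => ?_) t
      simp [add_smul, tmul_add]
    zero_smul := fun t => by
      refine DFunLike.congr_fun (f := map _ _) (g := 0) (hom_ext fun m n => ?_) t
      simp }

theorem smul_tmul [Module A M] [SMulCommClass A Aᵐᵒᵖ M] (a : A) (m : M) (n : N) :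
    a • tmul A m n = tmul A (a • m) n := rfl

theorem op_smul_tmul_right [Module Aᵐᵒᵖ N] [SMulCommClass A Aᵐᵒᵖ N] (a : Aᵐᵒᵖ) (m : M) (n : N) :
    a • tmul A m n = tmul A m (a • n) := rfl

instance instSMulCommClass [Module A M] [SMulCommClass A Aᵐᵒᵖ M]
    [Module Aᵐᵒᵖ N] [SMulCommClass A Aᵐᵒᵖ N] : SMulCommClass A Aᵐᵒᵖ (BTensor A M N) where
  smul_comm a b t := by
    induction t using BTensor.induction_on with
    | h0 => simp
    | ht m n => rfl
    | ha x y hx hy => simp only [smul_add, hx, hy]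

end Actions

section Canonical

variable (A : Type u) (M : Type v₁) (N : Type v₂) (P : Type v₃) [Ring A]
  [AddCommGroup M] [Module Aᵐᵒᵖ M]
  [AddCommGroup N] [Module A N] [Module Aᵐᵒᵖ N] [SMulCommClass A Aᵐᵒᵖ N]
  [AddCommGroup P] [Module A P]

/-- The canonical map `A ⊗_A P → P`, `a ⊗ p ↦ a p`. -/
def lid : BTensor A A P →+ P :=
  lift (fun a p => a • p) add_smul smul_add (fun b a p => by simp [mul_smul])

/-- The canonical map `M ⊗_A A → M`, `m ⊗ a ↦ m a`. -/
def rid : BTensor A M A →+ M :=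
  lift (fun m a => op a • m) (fun m m' a => smul_add _ m m')
    (fun m a b => by rw [MulOpposite.op_add, add_smul]) (fun m a b => by simp [mul_smul])

variable {A M N P} in
/-- For fixed `p`, the map `m ⊗ n ↦ m ⊗ (n ⊗ p)`. -/
def assocAux (p : P) : BTensor A M N →+ BTensor A M (BTensor A N P) :=
  lift (fun m n => tmul A m (tmul A n p)) (fun m m' n => add_tmul A m m' _)
    (fun m n n' => by rw [add_tmul, tmul_add]) (fun m a n => op_smul_tmul A m a _)

variable {A M N P} in
/-- For fixed `m`, the map `n ⊗ p ↦ (m ⊗ n) ⊗ p`. -/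
def assocInvAux (m : M) : BTensor A N P →+ BTensor A (BTensor A M N) P :=
  lift (fun n p => tmul A (tmul A m n) p) (fun n n' p => by rw [tmul_add, add_tmul])
    (fun n p p' => tmul_add A _ p p') (fun n a p => op_smul_tmul A (tmul A m n) a p)

/-- The canonical isomorphism `(M ⊗_A N) ⊗_A P ≃ M ⊗_A (N ⊗_A P)`. -/
def assoc : BTensor A (BTensor A M N) P ≃+ BTensor A M (BTensor A N P) :=
  AddMonoidHom.toAddEquiv
    (lift (fun t p => assocAux p t)
      (fun t t' p => map_add _ t t')
      (fun t p p' => by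
        refine DFunLike.congr_fun (f := assocAux (p + p')) (g := assocAux p + assocAux p')
          (hom_ext fun m n => ?_) t
        exact (congrArg (tmul A m) (tmul_add A n p p')).trans (tmul_add A m _ _))
      (fun t a p => by
        induction t using BTensor.induction_on with
        | h0 => simp
        | ht m n =>
          change tmul A m (tmul A (op a • n) p) = tmul A m (tmul A n (a • p))
          rw [op_smul_tmul]
        | ha x y hx hy => rw [smul_add, map_add, map_add, hx, hy]))
    (lift (fun m t => assocInvAux m t)
      (fun m m' t => by
        refine DFunLike.congr_fun (f := assocInvAux (m + m'))
          (g := assocInvAux m + assocInvAux m') (hom_ext fun n p => ?_) t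
        exact (congrArg (fun x => tmul A x p) (add_tmul A m m' n)).trans (add_tmul A _ _ p))
      (fun m t t' => map_add _ t t')
      (fun m a t => by
        induction t using BTensor.induction_on with
        | h0 => simp
        | ht n p =>
          change tmul A (tmul A (op a • m) n) p = tmul A (tmul A m (a • n)) p
          rw [op_smul_tmul]
        | ha x y hx hy => rw [smul_add, map_add, map_add, hx, hy]))
    (by
      refine hom_ext (fun t p => ?_)
      induction t using BTensor.induction_on with
      | h0 => simp
      | ht m n => rfl
      | ha x y hx hy => rw [add_tmul, map_add, map_add, hx, hy])
    (by
      refine hom_ext (fun m t => ?_)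
      induction t using BTensor.induction_on with
      | h0 => simp
      | ht n p => rfl
      | ha x y hx hy => rw [tmul_add, map_add, map_add, hx, hy])

@[simp] theorem lid_tmul (a : A) (p : P) : lid A P (tmul A a p) = a • p := rfl

@[simp] theorem rid_tmul (m : M) (a : A) : rid A M (tmul A m a) = op a • m := rfl

@[simp] theorem assoc_tmul (m : M) (n : N) (p : P) :
    assoc A M N P (tmul A (tmul A m n) p) = tmul A m (tmul A n p) := rfl

end Canonical

end BTensor

/-- Homomorphisms of `(A, A)`-bimodules. -/
structure BimoduleHom (A : Type u) (M : Type v₁) (N : Type v₂) [Ring A]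
    [AddCommGroup M] [Module A M] [Module Aᵐᵒᵖ M]
    [AddCommGroup N] [Module A N] [Module Aᵐᵒᵖ N] where
  /-- The map, as a left linear map. -/
  left : M →ₗ[A] N
  map_op_smul : ∀ (a : Aᵐᵒᵖ) (m : M), left (a • m) = a • left m

/-- A bimodule homomorphism as a right linear map. -/
def BimoduleHom.right {A : Type u} {M : Type v₁} {N : Type v₂} [Ring A]
    [AddCommGroup M] [Module A M] [Module Aᵐᵒᵖ M]
    [AddCommGroup N] [Module A N] [Module Aᵐᵒᵖ N] (f : BimoduleHom A M N) : M →ₗ[Aᵐᵒᵖ] N where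
  toFun := f.left
  map_add' := f.left.map_add
  map_smul' := f.map_op_smul

/-- A (coassociative, counital) `A`-coring structure on an `(A, A)`-bimodule `C`. -/
class Coring (A : Type u) (C : Type v) [Ring A] [AddCommGroup C] [Module A C] [Module Aᵐᵒᵖ C]
    [SMulCommClass A Aᵐᵒᵖ C] where
  /-- The coproduct. -/
  comul : BimoduleHom A C (BTensor A C C)
  /-- The counit. -/
  counit : BimoduleHom A C A
  coassoc : ∀ c : C,
    BTensor.assoc A C C C (BTensor.map comul.right LinearMap.id (comul.left c)) =
      BTensor.map LinearMap.id comul.left (comul.left c)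
  counit_comul : ∀ c : C,
    BTensor.lid A C (BTensor.map counit.right LinearMap.id (comul.left c)) = c
  comul_counit : ∀ c : C,
    BTensor.rid A C (BTensor.map LinearMap.id counit.left (comul.left c)) = c

section Comodules

variable (A C : Type u) [Ring A] [AddCommGroup C] [Module A C] [Module Aᵐᵒᵖ C]
  [SMulCommClass A Aᵐᵒᵖ C] [Coring A C]

/-- Right comodules over an `A`-coring `C`. -/
structure RightComodule where
  /-- The underlying right `A`-module. -/
  carrier : ModuleCat.{u} Aᵐᵒᵖ
  /-- The coaction. -/
  coact : carrier →ₗ[Aᵐᵒᵖ] BTensor A carrier C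
  coassoc : ∀ m : carrier,
    BTensor.assoc A carrier C C (BTensor.map coact LinearMap.id (coact m)) =
      BTensor.map LinearMap.id (Coring.comul (A := A) (C := C)).left (coact m)
  coact_counit : ∀ m : carrier,
    BTensor.rid A carrier
      (BTensor.map LinearMap.id (Coring.counit (A := A) (C := C)).left (coact m)) = m

namespace RightComodule

variable {A C}

/-- Morphisms of right comodules: right `A`-linear maps commuting with the coactions. -/
@[ext]
structure Hom (M N : RightComodule A C) where
  /-- The underlying map of right `A`-modules. -/
  hom : M.carrier ⟶ N.carrier
  comm : ∀ m : M.carrier,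
    N.coact (hom.hom m) = BTensor.map hom.hom LinearMap.id (M.coact m)

instance instCategory : Category (RightComodule A C) where
  Hom := Hom
  id M :=
    { hom := 𝟙 M.carrier
      comm := fun m => by
        change M.coact m = BTensor.map LinearMap.id LinearMap.id (M.coact m)
        have h : BTensor.map (A := A) (LinearMap.id : M.carrier →ₗ[Aᵐᵒᵖ] M.carrier)
            (LinearMap.id : C →ₗ[A] C) = AddMonoidHom.id _ := BTensor.hom_ext (fun _ _ => rfl)
        rw [h]
        rfl }
  comp {M N P} f g :=
    { hom := f.hom ≫ g.hom
      comm := fun m => by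
        change P.coact (g.hom.hom (f.hom.hom m)) = _
        rw [g.comm, f.comm]
        have h : BTensor.map (A := A) (f.hom ≫ g.hom).hom (LinearMap.id : C →ₗ[A] C) =
            (BTensor.map g.hom.hom LinearMap.id).comp (BTensor.map f.hom.hom LinearMap.id) :=
          BTensor.hom_ext (fun _ _ => rfl)
        rw [h]
        rfl }
  id_comp f := Hom.ext (Category.id_comp f.hom)
  comp_id f := Hom.ext (Category.comp_id f.hom)
  assoc f g h := Hom.ext (Category.assoc f.hom g.hom h.hom)

variable (A C)

/-- The forgetful functor from right `C`-comodules to right `A`-modules. -/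
def forgetToModule : RightComodule A C ⥤ ModuleCat.{u} Aᵐᵒᵖ where
  obj M := M.carrier
  map f := Hom.hom f
  map_id _ := rfl
  map_comp _ _ := rfl

end RightComodule

end Comodules

/-- A Frobenius functor: one functor is both a right and a left adjoint of `F`. -/
def IsFrobeniusFunctor {D : Type v₁} {E : Type v₂} [Category.{v₃} D] [Category.{v₄} E]
    (F : D ⥤ E) : Prop :=
  ∃ G : E ⥤ D, Nonempty (F ⊣ G) ∧ Nonempty (G ⊣ F)

/-- `C` is a Frobenius coring if the forgetful functor `M^C → M_A` is a Frobenius functor. -/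
def IsFrobeniusCoring (A C : Type u) [Ring A] [AddCommGroup C] [Module A C] [Module Aᵐᵒᵖ C]
    [SMulCommClass A Aᵐᵒᵖ C] [Coring A C] : Prop :=
  IsFrobeniusFunctor (RightComodule.forgetToModule A C)

section Duals

variable (A : Type u) (C : Type v) [Ring A] [AddCommGroup C] [Module A C] [Module Aᵐᵒᵖ C]

/-- The right dual `C^* = Hom_{-A}(C, A)`. -/
def RightDual : Type (max u v) := C →ₗ[Aᵐᵒᵖ] A

/-- The left dual `^*C = Hom_{A-}(C, A)`. -/
def LeftDual : Type (max u v) := C →ₗ[A] A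

instance RightDual.instAddCommGroup : AddCommGroup (RightDual A C) :=
  inferInstanceAs (AddCommGroup (C →ₗ[Aᵐᵒᵖ] A))

instance LeftDual.instAddCommGroup : AddCommGroup (LeftDual A C) :=
  inferInstanceAs (AddCommGroup (C →ₗ[A] A))

instance RightDual.instFunLike : FunLike (RightDual A C) C A :=
  inferInstanceAs (FunLike (C →ₗ[Aᵐᵒᵖ] A) C A)

instance LeftDual.instFunLike : FunLike (LeftDual A C) C A :=
  inferInstanceAs (FunLike (C →ₗ[A] A) C A)

instance RightDual.instAddMonoidHomClass : AddMonoidHomClass (RightDual A C) C A :=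
  inferInstanceAs (AddMonoidHomClass (C →ₗ[Aᵐᵒᵖ] A) C A)

instance LeftDual.instAddMonoidHomClass : AddMonoidHomClass (LeftDual A C) C A :=
  inferInstanceAs (AddMonoidHomClass (C →ₗ[A] A) C A)

variable {A C}

@[ext]
theorem RightDual.ext {ξ η : RightDual A C} (h : ∀ c, ξ c = η c) : ξ = η := DFunLike.ext _ _ h

@[ext]
theorem LeftDual.ext {ξ η : LeftDual A C} (h : ∀ c, ξ c = η c) : ξ = η := DFunLike.ext _ _ h

/-- An element of `C^*` as a linear map. -/
def RightDual.toLinearMap (ξ : RightDual A C) : C →ₗ[Aᵐᵒᵖ] A := ξ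

/-- An element of `^*C` as a linear map. -/
def LeftDual.toLinearMap (ξ : LeftDual A C) : C →ₗ[A] A := ξ

/-- A right linear map as an element of `C^*`. -/
def RightDual.ofLinearMap (f : C →ₗ[Aᵐᵒᵖ] A) : RightDual A C := f

/-- A left linear map as an element of `^*C`. -/
def LeftDual.ofLinearMap (f : C →ₗ[A] A) : LeftDual A C := f

variable [SMulCommClass A Aᵐᵒᵖ C]

/-- The right linear map `C ⊗_A C → C`, `c ⊗ d ↦ ξ(c) d`. -/
def RightDual.contract (ξ : RightDual A C) : BTensor A C C →ₗ[Aᵐᵒᵖ] C where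
  toFun t := BTensor.lid A C
    (BTensor.map ξ.toLinearMap (LinearMap.id : C →ₗ[A] C) t)
  map_add' s t := by rw [map_add, map_add]
  map_smul' a t := by
    induction t using BTensor.induction_on with
    | h0 => simp
    | ht c d => exact smul_comm (ξ c) a d
    | ha x y hx hy => rw [smul_add, map_add, map_add, hx, hy, map_add, map_add, smul_add]

/-- The left linear map `C ⊗_A C → C`, `c ⊗ d ↦ c ξ(d)`. -/
def LeftDual.contract (ξ : LeftDual A C) : BTensor A C C →ₗ[A] C where
  toFun t := BTensor.rid A C
    (BTensor.map (LinearMap.id : C →ₗ[Aᵐᵒᵖ] C) ξ.toLinearMap t)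
  map_add' s t := by rw [map_add, map_add]
  map_smul' a t := by
    induction t using BTensor.induction_on with
    | h0 => simp
    | ht c d => exact (smul_comm a (op (ξ d)) c).symm
    | ha x y hx hy => rw [smul_add, map_add, map_add, hx, hy, map_add, map_add, smul_add]

@[simp] theorem RightDual.contract_tmul (ξ : RightDual A C) (c d : C) :
    ξ.contract (BTensor.tmul A c d) = ξ c • d := rfl

@[simp] theorem LeftDual.contract_tmul (ξ : LeftDual A C) (c d : C) :
    ξ.contract (BTensor.tmul A c d) = op (ξ d) • c := rfl

variable [Coring A C]

/-- The map `C → C`, `c ↦ ∑ ξ(c₍₁₎) c₍₂₎`. -/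
def RightDual.act (ξ : RightDual A C) : C →ₗ[Aᵐᵒᵖ] C :=
  ξ.contract ∘ₗ (Coring.comul (A := A) (C := C)).right

/-- The map `C → C`, `c ↦ ∑ c₍₁₎ ξ(c₍₂₎)`. -/
def LeftDual.act (ξ : LeftDual A C) : C →ₗ[A] C :=
  ξ.contract ∘ₗ (Coring.comul (A := A) (C := C)).left

/-- The product `(ξ ξ')(c) = ∑ ξ(ξ'(c₍₁₎) c₍₂₎)` on `C^*`. -/
instance RightDual.instMul : Mul (RightDual A C) where
  mul ξ ξ' := ofLinearMap (ξ.toLinearMap ∘ₗ ξ'.act)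

/-- The product `(ξ ξ')(c) = ∑ ξ'(c₍₁₎ ξ(c₍₂₎))` on `^*C`. -/
instance LeftDual.instMul : Mul (LeftDual A C) where
  mul ξ ξ' := ofLinearMap (ξ'.toLinearMap ∘ₗ ξ.act)

/-- The unit of `C^*` is the counit of `C`. -/
instance RightDual.instOne : One (RightDual A C) where
  one := ofLinearMap (Coring.counit (A := A) (C := C)).right

/-- The unit of `^*C` is the counit of `C`. -/
instance LeftDual.instOne : One (LeftDual A C) where
  one := ofLinearMap (Coring.counit (A := A) (C := C)).left

theorem RightDual.mul_apply (ξ ξ' : RightDual A C) (c : C) : (ξ * ξ') c = ξ (ξ'.act c) := rfl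

theorem LeftDual.mul_apply (ξ ξ' : LeftDual A C) (c : C) : (ξ * ξ') c = ξ' (ξ.act c) := rfl

theorem RightDual.act_one (c : C) : (1 : RightDual A C).act c = c := Coring.counit_comul c

theorem LeftDual.act_one (c : C) : (1 : LeftDual A C).act c = c := Coring.comul_counit c

theorem RightDual.one_act (ξ : RightDual A C) (c : C) : (1 : RightDual A C) (ξ.act c) = ξ c := by
  have key : ∀ t : BTensor A C C, (1 : RightDual A C) (ξ.contract t) =
      ξ (BTensor.rid A C
        (BTensor.map LinearMap.id (Coring.counit (A := A) (C := C)).left t)) := by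
    intro t
    induction t using BTensor.induction_on with
    | h0 => simp only [map_zero]
    | ht c d =>
      exact ((Coring.counit (A := A) (C := C)).left.map_smul (ξ c) d).trans
        (ξ.toLinearMap.map_smul (op ((Coring.counit (A := A) (C := C)).left d)) c).symm
    | ha x y hx hy => simp only [map_add, hx, hy]
  exact (key _).trans (congrArg ξ (Coring.comul_counit c))

theorem LeftDual.one_act (ξ : LeftDual A C) (c : C) : (1 : LeftDual A C) (ξ.act c) = ξ c := by
  have key : ∀ t : BTensor A C C, (1 : LeftDual A C) (ξ.contract t) =
      ξ (BTensor.lid A C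
        (BTensor.map (Coring.counit (A := A) (C := C)).right LinearMap.id t)) := by
    intro t
    induction t using BTensor.induction_on with
    | h0 => simp only [map_zero]
    | ht c d =>
      exact ((Coring.counit (A := A) (C := C)).map_op_smul (op (ξ d)) c).trans
        (ξ.toLinearMap.map_smul ((Coring.counit (A := A) (C := C)).left c) d).symm
    | ha x y hx hy => simp only [map_add, hx, hy]
  exact (key _).trans (congrArg ξ (Coring.counit_comul c))

theorem RightDual.act_act (ξ ξ' : RightDual A C) (c : C) :
    ξ.act (ξ'.act c) = (ξ * ξ').act c := by
  have h₁ : ∀ t : BTensor A C C, ξ.act (ξ'.contract t) =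
      ξ.contract (BTensor.lid A _ (BTensor.map ξ'.toLinearMap LinearMap.id
        (BTensor.map LinearMap.id (Coring.comul (A := A) (C := C)).left t))) := by
    intro t
    induction t using BTensor.induction_on with
    | h0 => simp only [map_zero]
    | ht c d =>
      exact congrArg ξ.contract ((Coring.comul (A := A) (C := C)).left.map_smul (ξ' c) d)
    | ha x y hx hy => simp only [map_add, hx, hy]
  have h₂ : ∀ t : BTensor A (BTensor A C C) C,
      ξ.contract (BTensor.lid A _ (BTensor.map ξ'.toLinearMap LinearMap.id
        (BTensor.assoc A C C C t))) =
      BTensor.lid A C (BTensor.map (ξ.toLinearMap ∘ₗ ξ'.contract)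
        LinearMap.id t) := by
    intro t
    induction t using BTensor.induction_on with
    | h0 => simp only [map_zero]
    | ht s d =>
      induction s using BTensor.induction_on with
      | h0 => simp only [BTensor.zero_tmul, map_zero]
      | ht c c' => rfl
      | ha x y hx hy => simp only [BTensor.add_tmul, map_add, hx, hy]
    | ha x y hx hy => simp only [map_add, hx, hy]
  have h₃ : ∀ t : BTensor A C C,
      BTensor.lid A C (BTensor.map (ξ.toLinearMap ∘ₗ ξ'.contract) LinearMap.id
        (BTensor.map (Coring.comul (A := A) (C := C)).right LinearMap.id t)) =
      (ξ * ξ').contract t := by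
    intro t
    induction t using BTensor.induction_on with
    | h0 => simp only [map_zero]
    | ht s d => rfl
    | ha x y hx hy => simp only [map_add, hx, hy]
  refine (h₁ ((Coring.comul (A := A) (C := C)).left c)).trans ?_
  rw [← Coring.coassoc, h₂, h₃]
  rfl

theorem LeftDual.act_act (ξ ξ' : LeftDual A C) (c : C) :
    ξ'.act (ξ.act c) = (ξ * ξ').act c := by
  have h₁ : ∀ t : BTensor A C C, ξ'.act (ξ.contract t) =
      ξ'.contract (BTensor.rid A _ (BTensor.map LinearMap.id ξ.toLinearMap
        (BTensor.map (Coring.comul (A := A) (C := C)).right LinearMap.id t))) := by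
    intro t
    induction t using BTensor.induction_on with
    | h0 => simp only [map_zero]
    | ht c d =>
      exact congrArg ξ'.contract ((Coring.comul (A := A) (C := C)).map_op_smul (op (ξ d)) c)
    | ha x y hx hy => simp only [map_add, hx, hy]
  have h₂ : ∀ t : BTensor A (BTensor A C C) C,
      ξ'.contract (BTensor.rid A _ (BTensor.map LinearMap.id ξ.toLinearMap t)) =
      BTensor.rid A C (BTensor.map LinearMap.id (ξ'.toLinearMap ∘ₗ ξ.contract)
        (BTensor.assoc A C C C t)) := by
    intro t
    induction t using BTensor.induction_on with
    | h0 => simp only [map_zero]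
    | ht s d =>
      induction s using BTensor.induction_on with
      | h0 => simp only [BTensor.zero_tmul, map_zero]
      | ht c c' =>
        change op (ξ' (op (ξ d) • c')) • c = _
        rfl
      | ha x y hx hy => simp only [BTensor.add_tmul, map_add, hx, hy]
    | ha x y hx hy => simp only [map_add, hx, hy]
  have h₃ : ∀ t : BTensor A C C,
      BTensor.rid A C (BTensor.map LinearMap.id (ξ'.toLinearMap ∘ₗ ξ.contract)
        (BTensor.map LinearMap.id (Coring.comul (A := A) (C := C)).left t)) =
      (ξ * ξ').contract t := by
    intro t
    induction t using BTensor.induction_on with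
    | h0 => simp only [map_zero]
    | ht s d => rfl
    | ha x y hx hy => simp only [map_add, hx, hy]
  refine (h₁ _).trans ?_
  rw [h₂, Coring.coassoc, h₃]
  rfl

theorem RightDual.add_act (ξ η : RightDual A C) (c : C) :
    (ξ + η).act c = ξ.act c + η.act c := by
  have key : ∀ t : BTensor A C C,
      (ξ + η).contract t = ξ.contract t + η.contract t := by
    intro t
    induction t using BTensor.induction_on with
    | h0 => simp only [map_zero, add_zero]
    | ht c d => exact add_smul (ξ c) (η c) d
    | ha x y hx hy => rw [map_add, map_add, map_add, hx, hy]; abel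
  exact key _

theorem LeftDual.add_act (ξ η : LeftDual A C) (c : C) :
    (ξ + η).act c = ξ.act c + η.act c := by
  have key : ∀ t : BTensor A C C,
      (ξ + η).contract t = ξ.contract t + η.contract t := by
    intro t
    induction t using BTensor.induction_on with
    | h0 => simp only [map_zero, add_zero]
    | ht c d => exact add_smul (op (ξ d)) (op (η d)) c
    | ha x y hx hy => rw [map_add, map_add, map_add, hx, hy]; abel
  exact key _

/-- The ring `C^*`. -/
instance RightDual.instRing : Ring (RightDual A C) :=
  { RightDual.instAddCommGroup A C, RightDual.instMul, RightDual.instOne with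
    mul_assoc := fun ξ η ζ => RightDual.ext fun c => congrArg ξ (RightDual.act_act η ζ c)
    one_mul := fun ξ => RightDual.ext fun c => RightDual.one_act ξ c
    mul_one := fun ξ => RightDual.ext fun c => congrArg ξ (RightDual.act_one c)
    left_distrib := fun ξ η ζ => RightDual.ext fun c =>
      (congrArg ξ (RightDual.add_act η ζ c)).trans (map_add ξ _ _)
    right_distrib := fun _ _ _ => RightDual.ext fun _ => rfl
    zero_mul := fun _ => RightDual.ext fun _ => rfl
    mul_zero := fun ξ => by
      have h : ξ * (0 + 0) = ξ * 0 + ξ * 0 := RightDual.ext fun c =>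
        (congrArg ξ (RightDual.add_act 0 0 c)).trans (map_add ξ _ _)
      rw [add_zero] at h
      exact left_eq_add.1 h }

/-- The ring `^*C`. -/
instance LeftDual.instRing : Ring (LeftDual A C) :=
  { LeftDual.instAddCommGroup A C, LeftDual.instMul, LeftDual.instOne with
    mul_assoc := fun ξ η ζ => LeftDual.ext fun c => (congrArg ζ (LeftDual.act_act ξ η c)).symm
    one_mul := fun ξ => LeftDual.ext fun c => congrArg ξ (LeftDual.act_one c)
    mul_one := fun ξ => LeftDual.ext fun c => LeftDual.one_act ξ c
    left_distrib := fun _ _ _ => LeftDual.ext fun _ => rfl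
    right_distrib := fun ξ η ζ => LeftDual.ext fun c =>
      (congrArg ζ (LeftDual.add_act ξ η c)).trans (map_add ζ _ _)
    mul_zero := fun _ => LeftDual.ext fun _ => rfl
    zero_mul := fun ξ => by
      have h : (0 + 0) * ξ = 0 * ξ + 0 * ξ := LeftDual.ext fun c =>
        (congrArg ξ (LeftDual.add_act 0 0 c)).trans (map_add ξ _ _)
      rw [add_zero] at h
      exact left_eq_add.1 h }

variable (A C)

/-- The ring homomorphism `ι^* : A → C^*`, `a ↦ ε(a -) = a ε(-)`. -/
def RightDual.iota : A →+* RightDual A C where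
  toFun a := ofLinearMap (a • (Coring.counit (A := A) (C := C)).right)
  map_one' := one_smul A (Coring.counit (A := A) (C := C)).right
  map_zero' := zero_smul A (Coring.counit (A := A) (C := C)).right
  map_add' a b := add_smul a b (Coring.counit (A := A) (C := C)).right
  map_mul' a b := RightDual.ext fun c => by
    set β : RightDual A C := ofLinearMap (b • (Coring.counit (A := A) (C := C)).right) with hβ
    change (a * b) * (1 : RightDual A C) c = a * (1 : RightDual A C) (β.act c)
    rw [RightDual.one_act]
    exact mul_assoc a b _

/-- The ring homomorphism `^*ι : A → ^*C`, `a ↦ ε(- a) = ε(-) a`. -/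
def LeftDual.iota : A →+* LeftDual A C where
  toFun a := ofLinearMap (op a • (Coring.counit (A := A) (C := C)).left)
  map_one' := one_smul Aᵐᵒᵖ (Coring.counit (A := A) (C := C)).left
  map_zero' := zero_smul Aᵐᵒᵖ (Coring.counit (A := A) (C := C)).left
  map_add' a b := add_smul (op a) (op b) (Coring.counit (A := A) (C := C)).left
  map_mul' a b := LeftDual.ext fun c => by
    set α : LeftDual A C := ofLinearMap (op a • (Coring.counit (A := A) (C := C)).left) with hα
    change (1 : LeftDual A C) c * (a * b) = (1 : LeftDual A C) (α.act c) * b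
    rw [LeftDual.one_act]
    exact (mul_assoc _ a b).symm

theorem RightDual.iota_apply (a : A) (c : C) :
    RightDual.iota A C a c = (Coring.counit (A := A) (C := C)).left (a • c) :=
  ((Coring.counit (A := A) (C := C)).left.map_smul a c).symm

theorem LeftDual.iota_apply (a : A) (c : C) :
    LeftDual.iota A C a c = (Coring.counit (A := A) (C := C)).left (op a • c) :=
  ((Coring.counit (A := A) (C := C)).map_op_smul (op a) c).symm

end Duals

section Reflexive

variable (A : Type u) (M : Type v) [Ring A] [AddCommGroup M]

/-- The evaluation map `M → Hom_{-A}(Hom_{A-}(M, A), A)` of a left module, where `A` acts on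
`Hom_{A-}(M, A)` from the right through `(ξ a)(m) = ξ(m) a`. -/
def leftEval [Module A M] (m : M) : (M →ₗ[A] A) →ₗ[Aᵐᵒᵖ] A where
  toFun ξ := ξ m
  map_add' _ _ := rfl
  map_smul' _ _ := rfl

/-- The evaluation map `M → Hom_{A-}(Hom_{-A}(M, A), A)` of a right module, where `A` acts on
`Hom_{-A}(M, A)` from the left through `(a ξ)(m) = a ξ(m)`. -/
def rightEval [Module Aᵐᵒᵖ M] (m : M) : (M →ₗ[Aᵐᵒᵖ] A) →ₗ[A] A where
  toFun ξ := ξ m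
  map_add' _ _ := rfl
  map_smul' _ _ := rfl

/-- Reflexivity of a left module. -/
def IsLeftReflexive [Module A M] : Prop := Function.Bijective (leftEval A M)

/-- Reflexivity of a right module. -/
def IsRightReflexive [Module Aᵐᵒᵖ M] : Prop := Function.Bijective (rightEval A M)

end Reflexive

/-- A ring homomorphism `f : R → S` is a Frobenius extension if `S` is finitely generated
projective as a right `R`-module and `S ≅ Hom_{-R}(S, R)` as `(R, S)`-bimodules, where
`(r φ s)(y) = r φ(s y)`. -/
def IsFrobeniusExtension {R : Type u} {S : Type v} [Ring R] [Ring S] (f : R →+* S) : Prop :=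
  letI : Module Rᵐᵒᵖ S := Module.compHom S (RingHom.op f)
  Module.Finite Rᵐᵒᵖ S ∧ Module.Projective Rᵐᵒᵖ S ∧
    ∃ Φ : S ≃+ (S →ₗ[Rᵐᵒᵖ] R), ∀ (r : R) (x s y : S), Φ (f r * x * s) y = r * Φ x (s * y)

/-! The forgetful functor always has the right adjoint `- ⊗_A C`, so by uniqueness of adjoints `C`
is Frobenius exactly when `- ⊗_A C` is also left adjoint to it. Naturality reduces such an
adjunction to a little data on `C`. The unit is `n ↦ n ⊗ e` for one central `e : C`, read off at the
module `A`. The counit at the comodule `C` is a map `κ : C ⊗_A C → C`, colinear on both sides and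
therefore recovered from `σ = ε ∘ κ`; conversely `σ` yields the counit `m ⊗ c ↦ m₍₀₎ σ(m₍₁₎ ⊗ c)` at
any comodule. Colinearity of `κ` becomes `c₍₁₎ σ(c₍₂₎ ⊗ d) = σ(c ⊗ d₍₁₎) d₍₂₎`, and the triangle
identities become `σ(e ⊗ c) = ε(c) = σ(c ⊗ e)`. This is
`isFrobeniusCoring_iff_nonempty_frobeniusSystem`.

The rings `C^*` and `^*C` act on `C` from the left and from the right by `ξ(c₍₁₎) c₍₂₎` and `c₍₁₎
ξ(c₍₂₎)`, and the two actions commute. In a Frobenius system `C` is free of rank one on `e` over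
each ring: the orbit maps of `e` are bijective, with inverses `c ↦ σ(c ⊗ -)` and `c ↦ σ(- ⊗ c)`.
Conversely, one bijective orbit map of a central `e` determines `σ`, once linear forms separate the
points of `C` (`ofRightDual`, `ofLeftDual`).

A Frobenius isomorphism `Φ` of a dual ring has the form `Φ ξ η = θ(ξ η)`, where `θ = Φ 1` is
`A`-linear on both sides. Reflexivity of `C` makes `θ` the evaluation at some `e`, and two-sided
linearity of `θ` makes `e` central. Bijectivity of `Φ` then translates, through reflexivity, into
bijectivity of the orbit map of `e`. Finite projectivity comes from `c = e₍₁₎ σ(e₍₂₎ ⊗ c)`, which is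
a dual basis expansion. -/

namespace BTensor

/-! ### Functoriality of the balanced tensor product -/

section Functoriality

variable {A : Type u} [Ring A] {M : Type v₁} {M' : Type v₂} {N : Type v₃} {P : Type v₄}
  [AddCommGroup M] [Module Aᵐᵒᵖ M] [AddCommGroup M'] [Module Aᵐᵒᵖ M']
  [AddCommGroup N] [Module A N] [Module Aᵐᵒᵖ N] [SMulCommClass A Aᵐᵒᵖ N]
  [AddCommGroup P] [Module A P]

/-- The right linear map `f ⊗ N : M ⊗_A N → M' ⊗_A N`. -/
def rmap (f : M →ₗ[Aᵐᵒᵖ] M') : BTensor A M N →ₗ[Aᵐᵒᵖ] BTensor A M' N where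
  toFun := map f LinearMap.id
  map_add' := map_add _
  map_smul' a t := by
    induction t using BTensor.induction_on with
    | h0 => simp
    | ht m n => rfl
    | ha x y hx hy => simp only [smul_add, map_add, hx, hy]

/-- The right linear map `n ↦ m ⊗ n`. -/
def tmulRight (N : Type v₃) [AddCommGroup N] [Module A N] [Module Aᵐᵒᵖ N]
    [SMulCommClass A Aᵐᵒᵖ N] (m : M) : N →ₗ[Aᵐᵒᵖ] BTensor A M N where
  toFun n := tmul A m n
  map_add' := tmul_add A m
  map_smul' _ _ := rfl

theorem map_id_map {M'' : Type*} [AddCommGroup M''] [Module Aᵐᵒᵖ M'']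
    (g : M' →ₗ[Aᵐᵒᵖ] M'') (f : M →ₗ[Aᵐᵒᵖ] M') (t : BTensor A M P) :
    map g LinearMap.id (map f LinearMap.id t) = map (g ∘ₗ f) LinearMap.id t :=
  DFunLike.congr_fun (hom_ext (f := (map g LinearMap.id).comp (map f LinearMap.id))
    (g := map (g ∘ₗ f) LinearMap.id) (fun _ _ => rfl)) t

theorem map_map_id {P' P'' : Type*} [AddCommGroup P'] [Module A P'] [AddCommGroup P'']
    [Module A P''] (g : P' →ₗ[A] P'') (f : P →ₗ[A] P') (t : BTensor A M P) :
    map LinearMap.id g (map LinearMap.id f t) = map LinearMap.id (g ∘ₗ f) t :=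
  DFunLike.congr_fun (hom_ext (f := (map LinearMap.id g).comp (map LinearMap.id f))
    (g := map LinearMap.id (g ∘ₗ f)) (fun _ _ => rfl)) t

theorem map_id_comm {P' : Type*} [AddCommGroup P'] [Module A P']
    (f : M →ₗ[Aᵐᵒᵖ] M') (g : P →ₗ[A] P') (t : BTensor A M P) :
    map f LinearMap.id (map LinearMap.id g t) = map LinearMap.id g (map f LinearMap.id t) :=
  DFunLike.congr_fun (hom_ext (f := (map f LinearMap.id).comp (map LinearMap.id g))
    (g := (map LinearMap.id g).comp (map f LinearMap.id)) (fun _ _ => rfl)) t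

theorem map_id_id (t : BTensor A M P) : map LinearMap.id LinearMap.id t = t :=
  DFunLike.congr_fun (hom_ext (f := map LinearMap.id LinearMap.id) (g := AddMonoidHom.id _)
    (fun _ _ => rfl)) t

theorem assoc_map_rmap (f : M →ₗ[Aᵐᵒᵖ] M') (t : BTensor A (BTensor A M N) P) :
    assoc A M' N P (map (rmap f) LinearMap.id t) = map f LinearMap.id (assoc A M N P t) := by
  induction t using BTensor.induction_on with
  | h0 => simp
  | ht s p =>
    induction s using BTensor.induction_on with
    | h0 => simp
    | ht m n => rfl
    | ha x y hx hy => simp only [add_tmul, map_add, hx, hy]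
  | ha x y hx hy => simp only [map_add, hx, hy]

theorem rid_map (f : M →ₗ[Aᵐᵒᵖ] M') (t : BTensor A M A) :
    rid A M' (map f LinearMap.id t) = f (rid A M t) := by
  induction t using BTensor.induction_on with
  | h0 => simp
  | ht m a => exact (f.map_smul (op a) m).symm
  | ha x y hx hy => simp only [map_add, hx, hy]

end Functoriality

end BTensor

/-! ### Cofree comodules and the right adjoint of the forgetful functor -/

namespace RightComodule

open BTensor

variable {A C : Type u} [Ring A] [AddCommGroup C] [Module A C] [Module Aᵐᵒᵖ C]
  [SMulCommClass A Aᵐᵒᵖ C] [Coring A C]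

local notation "Δ" => Coring.comul (A := A) (C := C)
local notation "ε" => Coring.counit (A := A) (C := C)

section Cofree

variable (C) (N : Type u) [AddCommGroup N] [Module Aᵐᵒᵖ N]

/-- The coaction `n ⊗ c ↦ (n ⊗ c₍₁₎) ⊗ c₍₂₎` on `N ⊗_A C`. -/
def cofreeCoact : BTensor A N C →ₗ[Aᵐᵒᵖ] BTensor A (BTensor A N C) C where
  toFun t := (assoc A N C C).symm (map LinearMap.id (Δ).left t)
  map_add' x y := by simp only [map_add]
  map_smul' a t := by
    induction t using BTensor.induction_on with
    | h0 => simp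
    | ht n c =>
      change (assoc A N C C).symm (tmul A n ((Δ).left (a • c))) =
        a • (assoc A N C C).symm (tmul A n ((Δ).left c))
      rw [(Δ).map_op_smul]
      generalize (Δ).left c = s
      change assocInvAux n (a • s) = a • assocInvAux n s
      exact (rmap (N := C) (tmulRight (A := A) C n)).map_smul a s
    | ha x y hx hy => simp only [smul_add, map_add, hx, hy]

theorem cofreeCoact_tmul (n : N) (c : C) :
    cofreeCoact (A := A) C N (tmul A n c) = map (tmulRight C n) LinearMap.id ((Δ).left c) := rfl

/-- The counit `n ⊗ c ↦ n ε(c)` of `N ⊗_A C`. -/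
def cofreeCounit : BTensor A N C →ₗ[Aᵐᵒᵖ] N where
  toFun t := rid A N (map LinearMap.id (ε).left t)
  map_add' x y := by simp only [map_add]
  map_smul' a t := by
    induction t using BTensor.induction_on with
    | h0 => simp
    | ht n c =>
      change op ((ε).left (a • c)) • n = a • op ((ε).left c) • n
      rw [(ε).map_op_smul, ← mul_smul]
      rfl
    | ha x y hx hy => simp only [smul_add, map_add, hx, hy]

end Cofree

/-- The comodule `N ⊗_A C`. -/
def cofree (N : ModuleCat.{u} Aᵐᵒᵖ) : RightComodule A C where
  carrier := ModuleCat.of Aᵐᵒᵖ (BTensor A N C)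
  coact := cofreeCoact C N
  coassoc t := by
    induction t using BTensor.induction_on with
    | h0 => simp
    | ht n c =>
      -- The map `n ⊗ -` intertwines `Δ` with the coaction of `N ⊗_A C`, so coassociativity is
      -- inherited from that of `C`.
      have h : cofreeCoact (A := A) C N ∘ₗ tmulRight C n =
          rmap (tmulRight C n) ∘ₗ (Δ).right := rfl
      change assoc A (BTensor A N C) C C (map (cofreeCoact C N) LinearMap.id
        (map (tmulRight C n) LinearMap.id ((Δ).left c))) =
        map LinearMap.id (Δ).left (map (tmulRight C n) LinearMap.id ((Δ).left c))
      rw [map_id_map, h, ← map_id_map, assoc_map_rmap, Coring.coassoc, map_id_comm]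
    | ha x y hx hy => rw [map_add, map_add, map_add, hx, hy, map_add]
  coact_counit t := by
    induction t using BTensor.induction_on with
    | h0 => simp
    | ht n c =>
      change rid A (BTensor A N C) (map LinearMap.id (ε).left
        (map (tmulRight C n) LinearMap.id ((Δ).left c))) = tmul A n c
      rw [← map_id_comm, rid_map, Coring.comul_counit]
      rfl
    | ha x y hx hy => rw [map_add, map_add, map_add, hx, hy]

variable (A C) in
/-- The coring as a right comodule over itself. -/
def self : RightComodule A C where
  carrier := ModuleCat.of Aᵐᵒᵖ C
  coact := (Δ).right
  coassoc := Coring.coassoc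
  coact_counit := Coring.comul_counit

variable (A C) in
/-- The functor `N ↦ N ⊗_A C` from right modules to right comodules. -/
def cofreeFunctor : ModuleCat.{u} Aᵐᵒᵖ ⥤ RightComodule A C where
  obj N := cofree N
  map {N N'} f :=
    { hom := ModuleCat.ofHom (rmap f.hom)
      comm := fun t => by
        change cofreeCoact C N' (rmap f.hom t) =
          map (rmap f.hom) LinearMap.id (cofreeCoact C N t)
        induction t using BTensor.induction_on with
        | h0 => simp
        | ht n c =>
          change cofreeCoact C N' (tmul A (f.hom n) c) = _
          rw [cofreeCoact_tmul, cofreeCoact_tmul, map_id_map]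
          rfl
        | ha x y hx hy => simp only [map_add, hx, hy] }
  map_id N := Hom.ext (ModuleCat.hom_ext (LinearMap.ext fun t => map_id_id t))
  map_comp f g := Hom.ext (ModuleCat.hom_ext (LinearMap.ext fun t =>
    (map_id_map g.hom f.hom t).symm))

/-- The coaction as a morphism of comodules `M ⟶ M ⊗_A C`. -/
def coactHom (M : RightComodule A C) : M ⟶ cofree M.carrier :=
  Hom.mk (N := cofree M.carrier) (ModuleCat.ofHom M.coact) fun m =>
    (AddEquiv.symm_apply_eq _).2 (M.coassoc m).symm

variable (A C) in
/-- The functor `N ↦ N ⊗_A C` is right adjoint to the forgetful functor. -/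
def forgetCofreeAdj : forgetToModule A C ⊣ cofreeFunctor A C :=
  Adjunction.mkOfUnitCounit
    { unit :=
        { app := fun M => coactHom M
          naturality := fun M M' f => Hom.ext (ModuleCat.hom_ext (LinearMap.ext fun m =>
            f.comm m)) }
      counit :=
        { app := fun N => ModuleCat.ofHom (cofreeCounit C N)
          naturality := fun N N' f => ModuleCat.hom_ext (LinearMap.ext fun t => by
            change cofreeCounit C N' (rmap f.hom t) = f.hom (cofreeCounit C N t)
            exact (congrArg (rid A N') (map_id_comm _ _ _).symm).trans (rid_map _ _)) }
      left_triangle := by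
        ext M m
        exact M.coact_counit m
      right_triangle := by
        refine NatTrans.ext (funext fun N => Hom.ext (ModuleCat.hom_ext
          (LinearMap.ext fun t => ?_)))
        change map (cofreeCounit C N) LinearMap.id (cofreeCoact C N t) = t
        induction t using BTensor.induction_on with
        | h0 => simp
        | ht n c =>
          rw [cofreeCoact_tmul, map_id_map]
          -- The identity `n ε(c₍₁₎) ⊗ c₍₂₎ = n ⊗ ε(c₍₁₎) c₍₂₎`, which reduces the triangle to the
          -- counit axiom of `C`.
          have h : ∀ s : BTensor A C C,
              map (cofreeCounit C N ∘ₗ tmulRight C n) LinearMap.id s =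
                tmul A n (lid A C (map (ε).right LinearMap.id s)) := by
            intro s
            induction s using BTensor.induction_on with
            | h0 => simp
            | ht c d => exact op_smul_tmul A n _ d
            | ha x y hx hy => simp only [map_add, hx, hy, tmul_add]
          rw [h, Coring.counit_comul]
        | ha x y hx hy => simp only [map_add, hx, hy] }

end RightComodule

/-! ### Frobenius systems -/

/-- A Frobenius system on a coring: a central element `e` and a bimodule map `σ : C ⊗_A C → A`,
given through its partial maps `right c = σ(c ⊗ -)` and `left c = σ(- ⊗ c)`, such that
`c₍₁₎ σ(c₍₂₎ ⊗ d) = σ(c ⊗ d₍₁₎) d₍₂₎` and `σ(e ⊗ c) = ε(c) = σ(c ⊗ e)`. -/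
structure FrobeniusSystem (A : Type u) (C : Type v) [Ring A] [AddCommGroup C] [Module A C]
    [Module Aᵐᵒᵖ C] [SMulCommClass A Aᵐᵒᵖ C] [Coring A C] where
  /-- The central element. -/
  e : C
  /-- The map `c ↦ σ(c ⊗ -)`. -/
  right : C → RightDual A C
  /-- The map `c ↦ σ(- ⊗ c)`. -/
  left : C → LeftDual A C
  smul_e : ∀ a : A, a • e = op a • e
  left_apply : ∀ c d, left d c = right c d
  balanced : ∀ (c : C) (a : A) (d : C), right (op a • c) d = right c (a • d)
  act_eq : ∀ c d, (left d).act c = (right c).act d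
  right_e : right e = 1
  left_e : left e = 1

namespace LeftDual

variable {A : Type u} {C : Type v} [Ring A] [AddCommGroup C] [Module A C]

theorem map_smul (ξ : LeftDual A C) (a : A) (c : C) : ξ (a • c) = a * ξ c :=
  ξ.toLinearMap.map_smul a c

end LeftDual

namespace RightDual

variable {A : Type u} {C : Type v} [Ring A] [AddCommGroup C] [Module Aᵐᵒᵖ C]

theorem map_op_smul (ξ : RightDual A C) (a : A) (c : C) : ξ (op a • c) = ξ c * a :=
  ξ.toLinearMap.map_smul (op a) c

end RightDual

namespace FrobeniusSystem

open BTensor RightComodule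

variable {A C : Type u} [Ring A] [AddCommGroup C] [Module A C] [Module Aᵐᵒᵖ C]
  [SMulCommClass A Aᵐᵒᵖ C] [Coring A C]

local notation "Δ" => Coring.comul (A := A) (C := C)
local notation "ε" => Coring.counit (A := A) (C := C)

/-! ### The Frobenius system of an adjunction -/

section OfAdjunction

variable (adj : cofreeFunctor A C ⊣ forgetToModule A C)

/-- The counit of the adjunction at a comodule `M`, as a map `M ⊗_A C → M`. -/
def counitMap (M : RightComodule A C) : BTensor A M.carrier C →ₗ[Aᵐᵒᵖ] M.carrier :=
  (Hom.hom (adj.counit.app M)).hom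

theorem counitMap_natural {M M' : RightComodule A C} (f : M ⟶ M') (t : BTensor A M.carrier C) :
    counitMap adj M' (map (Hom.hom f).hom LinearMap.id t) =
      (Hom.hom f).hom (counitMap adj M t) :=
  LinearMap.congr_fun (congrArg (fun g => ModuleCat.Hom.hom (Hom.hom g))
    (adj.counit.naturality f)) t

theorem counitMap_colinear (M : RightComodule A C) (t : BTensor A M.carrier C) :
    M.coact (counitMap adj M t) =
      map (counitMap adj M) LinearMap.id (cofreeCoact C M.carrier t) :=
  (adj.counit.app M).comm t

/-- The unit of the adjunction at a module `N`, as a map `N → N ⊗_A C`. -/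
def unitMap (N : ModuleCat.{u} Aᵐᵒᵖ) : N →ₗ[Aᵐᵒᵖ] BTensor A N C :=
  (adj.unit.app N).hom

theorem unitMap_natural {N N' : ModuleCat.{u} Aᵐᵒᵖ} (f : N →ₗ[Aᵐᵒᵖ] N') (n : N) :
    unitMap adj N' (f n) = map f LinearMap.id (unitMap adj N n) :=
  LinearMap.congr_fun (congrArg ModuleCat.Hom.hom
    (adj.unit.naturality (ModuleCat.ofHom f))) n

theorem counitMap_unitMap (M : RightComodule A C) (m : M.carrier) :
    counitMap adj M (unitMap adj M.carrier m) = m :=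
  LinearMap.congr_fun (congrArg ModuleCat.Hom.hom (adj.right_triangle_components M)) m

theorem counitMap_map_unitMap (N : ModuleCat.{u} Aᵐᵒᵖ) (t : BTensor A N C) :
    counitMap adj (cofree N) (map (unitMap adj N) LinearMap.id t) = t :=
  LinearMap.congr_fun (congrArg (fun g => ModuleCat.Hom.hom (Hom.hom g))
    (adj.left_triangle_components N)) t

/-- The endomorphism `c ↦ a c` of the comodule `C`. -/
def selfSMul (a : A) : self A C ⟶ self A C :=
  Hom.mk (M := self A C) (N := self A C)
    (ModuleCat.ofHom (X := C) (Y := C) (DistribSMul.toLinearMap Aᵐᵒᵖ C a)) fun c =>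
      (Δ).left.map_smul a c

/-- The morphism `c ↦ n ⊗ c` from `C` to `N ⊗_A C`. -/
def selfTmul (N : ModuleCat.{u} Aᵐᵒᵖ) (n : N) : self A C ⟶ cofree N :=
  Hom.mk (M := self A C) (N := cofree N)
    (ModuleCat.ofHom (X := C) (Y := BTensor A N C) (tmulRight C n)) fun _ => rfl

/-- Left multiplication by `a` is an endomorphism of the right comodule `C`, so this is naturality
of the counit. -/
theorem counitMap_smul (a : A) (c d : C) :
    counitMap adj (self A C) (tmul A (a • c) d) =
      a • (show C from counitMap adj (self A C) (tmul A (M := C) c d)) :=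
  counitMap_natural adj (selfSMul a) (tmul A (M := C) c d)

/-- The partial counit `c ↦ κ(c ⊗ d)`, where `κ : C ⊗_A C → C` is the counit at `C`. -/
def partialCounit (d : C) : C →ₗ[A] C where
  toFun c := counitMap adj (self A C) (tmul A (M := C) c d)
  map_add' c c' := (congrArg _ (add_tmul A (M := C) c c' d)).trans (map_add _ _ _)
  map_smul' a c := counitMap_smul adj a c d

/-- The map `C ⊗_A C → C` given by the counit at `C`. -/
def pairingMap : BTensor A C C →ₗ[Aᵐᵒᵖ] C := counitMap adj (self A C)

/-- Each `n ⊗ -` is a comodule morphism `C ⟶ N ⊗_A C`, and such maps reach every pure tensor;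
naturality therefore determines the counit at a cofree comodule from `κ`. -/
theorem counitMap_cofree (N : ModuleCat.{u} Aᵐᵒᵖ) (t : BTensor A N C) (d : C) :
    counitMap adj (cofree N) (tmul A (M := BTensor A N C) t d) =
      map LinearMap.id (partialCounit adj d) t := by
  induction t using BTensor.induction_on with
  | h0 =>
    rw [map_zero]
    exact (congrArg _ (zero_tmul (M := BTensor A N C) d)).trans (map_zero _)
  | ht n c => exact counitMap_natural adj (selfTmul N n) (tmul A (M := C) c d)
  | ha x y hx hy =>
    rw [map_add, ← hx, ← hy]
    exact (congrArg _ (add_tmul A (M := BTensor A N C) x y d)).trans (map_add _ _ _)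

/-- The right linear form `σ(c ⊗ -) = ε(κ(c ⊗ -))`. -/
def pairingRight (c : C) : RightDual A C :=
  RightDual.ofLinearMap ((ε).right ∘ₗ pairingMap adj ∘ₗ tmulRight C c)

/-- The left linear form `σ(- ⊗ d) = ε(κ(- ⊗ d))`. -/
def pairingLeft (d : C) : LeftDual A C :=
  LeftDual.ofLinearMap ((ε).left ∘ₗ partialCounit adj d)

theorem comul_pairingMap (t : BTensor A C C) :
    (Δ).left (pairingMap adj t) = map (pairingMap adj) LinearMap.id (cofreeCoact C C t) :=
  counitMap_colinear adj (self A C) t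

/-- Right colinearity of `κ` reads `Δ κ(c ⊗ d) = κ(c ⊗ d₍₁₎) ⊗ d₍₂₎`; applying `ε` to the first
factor recovers `κ` from `σ`. -/
theorem pairingRight_act (c d : C) :
    (pairingRight adj c).act d = pairingMap adj (tmul A c d) := by
  have h : (Δ).left (pairingMap adj (tmul A c d)) =
      map (pairingMap adj ∘ₗ tmulRight C c) LinearMap.id ((Δ).left d) := by
    rw [comul_pairingMap, cofreeCoact_tmul, map_id_map]
  rw [← Coring.counit_comul (A := A) (pairingMap adj (tmul A c d)), h, map_id_map]
  rfl

/-- `Δ` itself is a comodule morphism from `C` to the cofree comodule `C ⊗_A C`. Naturality along it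
is left colinearity of `κ`, `Δ κ(c ⊗ d) = c₍₁₎ ⊗ κ(c₍₂₎ ⊗ d)`, and `ε` is applied to the second
factor. Comparison with `pairingRight_act` gives the main axiom of a Frobenius system. -/
theorem pairingLeft_act (c d : C) :
    (pairingLeft adj d).act c = pairingMap adj (tmul A c d) := by
  have h : (Δ).left (pairingMap adj (tmul A c d)) =
      map LinearMap.id (partialCounit adj d) ((Δ).left c) := by
    refine Eq.trans ?_ (counitMap_cofree adj (ModuleCat.of Aᵐᵒᵖ C) ((Δ).left c) d)
    exact (counitMap_natural adj (coactHom (self A C)) (tmul A (M := C) c d)).symm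
  rw [← Coring.comul_counit (A := A) (pairingMap adj (tmul A c d)), h, map_map_id]
  rfl

/-- The element of `C` corresponding to the unit `A → A ⊗_A C`. -/
def unitElement : C := lid A C (unitMap adj (ModuleCat.of Aᵐᵒᵖ A) (1 : A))

/-- Naturality of the unit along the right linear map `A → N`, `1 ↦ n`. -/
theorem tmul_unitElement (N : ModuleCat.{u} Aᵐᵒᵖ) (n : N) :
    unitMap adj N n = tmul A n (unitElement adj) := by
  have h : ∀ t : BTensor A A C,
      map ((LinearMap.toSpanSingleton Aᵐᵒᵖ N n) ∘ₗ
        (opLinearEquiv Aᵐᵒᵖ : A ≃ₗ[Aᵐᵒᵖ] Aᵐᵒᵖ).toLinearMap) LinearMap.id t =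
      tmul A n (lid A C t) := by
    intro t
    induction t using BTensor.induction_on with
    | h0 => simp
    | ht a c => exact op_smul_tmul A n a c
    | ha x y hx hy => simp only [map_add, hx, hy, tmul_add]
  rw [unitElement, ← h]
  refine Eq.trans ?_ (unitMap_natural adj (N := ModuleCat.of Aᵐᵒᵖ A) (N' := N) _ (1 : A))
  exact congrArg _ (one_smul Aᵐᵒᵖ n).symm

theorem pairingMap_unitElement (c : C) : pairingMap adj (tmul A c (unitElement adj)) = c :=
  (congrArg _ (tmul_unitElement adj (ModuleCat.of Aᵐᵒᵖ C) c).symm).trans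
    (counitMap_unitMap adj (self A C) c)

/-- The triangle identity at the module `A`, read through `A ⊗_A C ≅ C`; the identity on the other
side is the triangle at the comodule `C`. -/
theorem pairingMap_unitElement_left (c : C) :
    pairingMap adj (tmul A (unitElement adj) c) = c := by
  have h := counitMap_map_unitMap adj (ModuleCat.of Aᵐᵒᵖ A) (tmul A (1 : A) c)
  have h₁ : map (unitMap adj (ModuleCat.of Aᵐᵒᵖ A)) LinearMap.id (tmul A (1 : A) c) =
      tmul A (tmul A (1 : A) (unitElement adj)) c :=
    congrArg (fun x => tmul A x c) (tmul_unitElement adj (ModuleCat.of Aᵐᵒᵖ A) (1 : A))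
  have h₂ := (congrArg (counitMap adj (cofree (ModuleCat.of Aᵐᵒᵖ A))) h₁).symm.trans h
  have h₃ := (counitMap_cofree adj (ModuleCat.of Aᵐᵒᵖ A)
    (tmul A (1 : A) (unitElement adj)) c).symm.trans h₂
  have h₄ := congrArg (lid A C) h₃
  change (1 : A) • _ = (1 : A) • c at h₄
  rwa [one_smul, one_smul] at h₄

/-- The unit at `A` is right linear, so `a ⊗ e = (1 ⊗ e) a`. -/
theorem smul_unitElement (a : A) : a • unitElement adj = op a • unitElement adj := by
  have h₁ : unitMap adj (ModuleCat.of Aᵐᵒᵖ A) (op a • (1 : A)) =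
      op a • unitMap adj (ModuleCat.of Aᵐᵒᵖ A) (1 : A) := (unitMap adj _).map_smul _ _
  rw [tmul_unitElement, tmul_unitElement] at h₁
  have h₂ := congrArg (lid A C) h₁
  change ((1 : A) * a) • unitElement adj = (1 : A) • op a • unitElement adj at h₂
  rwa [one_mul, one_smul] at h₂

/-- The Frobenius system of an adjunction `- ⊗_A C ⊣ forget`. -/
def ofAdjunction : FrobeniusSystem A C where
  e := unitElement adj
  right := pairingRight adj
  left := pairingLeft adj
  smul_e := smul_unitElement adj
  left_apply _ _ := rfl
  balanced c a d := congrArg (fun t => (ε).left (pairingMap adj t)) (op_smul_tmul A c a d)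
  act_eq c d := (pairingLeft_act adj c d).trans (pairingRight_act adj c d).symm
  right_e := RightDual.ext fun c => congrArg (ε).left (pairingMap_unitElement_left adj c)
  left_e := LeftDual.ext fun c => congrArg (ε).left (pairingMap_unitElement adj c)

end OfAdjunction

/-! ### The adjunction of a Frobenius system -/

section ToAdjunction

variable (S : FrobeniusSystem A C)

theorem left_add (c d : C) : S.left (c + d) = S.left c + S.left d :=
  LeftDual.ext fun b => by
    change _ = S.left c b + S.left d b
    rw [left_apply, left_apply, left_apply, map_add]

theorem left_smul (a : A) (c d : C) : S.left (a • c) d = S.left c (op a • d) := by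
  rw [left_apply, left_apply, balanced]

theorem left_op_smul (a : A) (c d : C) : S.left (op a • c) d = S.left c d * a := by
  rw [left_apply, left_apply, RightDual.map_op_smul]

variable (N : Type u) [AddCommGroup N] [Module Aᵐᵒᵖ N]

/-- The map `c ↦ n σ(d ⊗ c)` for a tensor `t = n ⊗ d`. -/
def pairTensor (t : BTensor A N C) : C →ₗ[Aᵐᵒᵖ] N where
  toFun c := rid A N (map LinearMap.id (S.left c).toLinearMap t)
  map_add' c d := by
    induction t using BTensor.induction_on with
    | h0 => simp
    | ht n b =>
      change op (S.left (c + d) b) • n = op (S.left c b) • n + op (S.left d b) • n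
      rw [left_add, ← add_smul]
      rfl
    | ha x y hx hy => simp only [map_add, hx, hy]; abel
  map_smul' a c := by
    induction t using BTensor.induction_on with
    | h0 => simp
    | ht n b =>
      change op (S.left (op a.unop • c) b) • n = a • op (S.left c b) • n
      rw [left_op_smul, ← mul_smul]
      rfl
    | ha x y hx hy => simp only [map_add, hx, hy, smul_add]

theorem pairTensor_add (t t' : BTensor A N C) :
    pairTensor S N (t + t') = pairTensor S N t + pairTensor S N t' :=
  LinearMap.ext fun c => by
    change rid A N _ = rid A N _ + rid A N _
    simp only [map_add]

/-- This balancedness lets the counit descend to `M ⊗_A C`. -/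
theorem pairTensor_op_smul (a : A) (t : BTensor A N C) (c : C) :
    pairTensor S N (op a • t) c = pairTensor S N t (a • c) := by
  induction t using BTensor.induction_on with
  | h0 => simp [pairTensor]
  | ht n b =>
    change op (S.left c (op a • b)) • n = op (S.left (a • c) b) • n
    rw [left_smul]
  | ha x y hx hy => rw [smul_add, pairTensor_add, pairTensor_add, LinearMap.add_apply,
      LinearMap.add_apply, hx, hy]

/-- For `t = n ⊗ b` both sides equal `n ⊗ σ(b ⊗ c₍₁₎) c₍₂₎`, by balancing on the left and by
`act_eq` on the right. With `coact_pairTensor` and coassociativity of `M` it makes the counit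
colinear. -/
theorem map_pairTensor (t : BTensor A N C) (c : C) :
    map (pairTensor S N t) LinearMap.id ((Δ).left c) =
      map LinearMap.id (S.left c).act t := by
  induction t using BTensor.induction_on with
  | h0 =>
    have h : pairTensor S N 0 = 0 := LinearMap.ext fun c => by simp [pairTensor]
    rw [h, map_zero]
    generalize (Δ).left c = s
    induction s using BTensor.induction_on with
    | h0 => simp
    | ht c d => simp
    | ha x y hx hy => rw [map_add, hx, hy, add_zero]
  | ht n b =>
    rw [map_tmul, act_eq]
    change _ = tmul A n ((S.right b).contract ((Δ).left c))
    generalize (Δ).left c = s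
    induction s using BTensor.induction_on with
    | h0 => simp
    | ht c d =>
      refine Eq.trans ?_ (op_smul_tmul A n (S.right b c) d)
      change tmul A (op (S.left c b) • n) d = _
      rw [left_apply]
    | ha x y hx hy => simp only [map_add, tmul_add, hx, hy]
  | ha x y hx hy =>
    rw [map_add, ← hx, ← hy, pairTensor_add]
    generalize (Δ).left c = s
    induction s using BTensor.induction_on with
    | h0 => simp
    | ht c d => exact add_tmul A _ _ d
    | ha x y hx hy => simp only [map_add, hx, hy]; abel

/-- The map `m ⊗ c ↦ m₍₀₎ σ(m₍₁₎ ⊗ c)` for a comodule `M`. -/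
def counitLinear (M : RightComodule A C) : BTensor A M.carrier C →ₗ[Aᵐᵒᵖ] M.carrier where
  toFun := BTensor.lift (fun m c => pairTensor S M.carrier (M.coact m) c)
    (fun m m' c => by rw [map_add, pairTensor_add, LinearMap.add_apply])
    (fun m c d => map_add _ c d)
    (fun m a c => by rw [map_smul, pairTensor_op_smul])
  map_add' := map_add _
  map_smul' a t := by
    induction t using BTensor.induction_on with
    | h0 => simp
    | ht m c => exact (pairTensor S M.carrier (M.coact m)).map_smul a c
    | ha x y hx hy => simp only [smul_add, map_add, hx, hy]

theorem counitLinear_comp_tmulRight (M : RightComodule A C) (m : M.carrier) :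
    counitLinear S M ∘ₗ tmulRight C m = pairTensor S M.carrier (M.coact m) := rfl

theorem coact_pairTensor (M : RightComodule A C) (t : BTensor A M.carrier C) (c : C) :
    M.coact (pairTensor S M.carrier t c) =
      map LinearMap.id (S.left c).contract
        (assoc A M.carrier C C (map M.coact LinearMap.id t)) := by
  induction t using BTensor.induction_on with
  | h0 => simp [pairTensor]
  | ht m b =>
    change M.coact (op (S.left c b) • m) = map LinearMap.id (S.left c).contract
        (assoc A M.carrier C C (tmul A (M.coact m) b))
    rw [map_smul]
    generalize M.coact m = s
    induction s using BTensor.induction_on with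
    | h0 => simp
    | ht n d => rfl
    | ha x y hx hy => simp only [smul_add, add_tmul, map_add, hx, hy]
  | ha x y hx hy => rw [pairTensor_add, LinearMap.add_apply, map_add, hx, hy]; simp only [map_add]

theorem counitLinear_natural {M M' : RightComodule A C} (f : M ⟶ M')
    (t : BTensor A M.carrier C) :
    counitLinear S M' (rmap (Hom.hom f).hom t) = (Hom.hom f).hom (counitLinear S M t) := by
  induction t using BTensor.induction_on with
  | h0 => simp
  | ht m c =>
    change pairTensor S _ (M'.coact ((Hom.hom f).hom m)) c =
      (Hom.hom f).hom (pairTensor S _ (M.coact m) c)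
    rw [f.comm]
    exact (congrArg (rid A _) (map_id_comm _ _ _).symm).trans (rid_map _ _)
  | ha x y hx hy => simp only [map_add, hx, hy]

/-- The counit of the adjunction `- ⊗_A C ⊣ forget`, as a comodule morphism. -/
def counitHom (M : RightComodule A C) : cofree M.carrier ⟶ M :=
  Hom.mk (M := cofree M.carrier) (ModuleCat.ofHom (X := BTensor A M.carrier C)
    (counitLinear S M)) fun t => by
      change M.coact (counitLinear S M t) =
        map (counitLinear S M) LinearMap.id (cofreeCoact C M.carrier t)
      induction t using BTensor.induction_on with
      | h0 => simp
      | ht m c =>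
        rw [cofreeCoact_tmul, map_id_map, counitLinear_comp_tmulRight, map_pairTensor]
        change M.coact (pairTensor S M.carrier (M.coact m) c) = _
        rw [coact_pairTensor, M.coassoc, map_map_id]
        rfl
      | ha x y hx hy => simp only [map_add, hx, hy]

/-- The right linear map `n ↦ n ⊗ e`. -/
def unitLinear : N →ₗ[Aᵐᵒᵖ] BTensor A N C where
  toFun n := tmul A n S.e
  map_add' n n' := add_tmul A n n' S.e
  map_smul' a n := by
    change tmul A (op a.unop • n) S.e = a • tmul A n S.e
    rw [op_smul_tmul, S.smul_e]
    rfl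

/-- The image of `n ⊗ c` is `n ⊗ e₍₁₎ σ(e₍₂₎ ⊗ c) = n ⊗ σ(e ⊗ c₍₁₎) c₍₂₎ = n ⊗ ε(c₍₁₎) c₍₂₎ = n ⊗
c`. -/
theorem counitLinear_map_unitLinear (N : ModuleCat.{u} Aᵐᵒᵖ) (t : BTensor A N C) :
    counitLinear S (cofree N) (map (unitLinear S N) LinearMap.id t) = t := by
  refine DFunLike.congr_fun (f := (counitLinear S (cofree N)).toAddMonoidHom.comp
    (map (unitLinear S N) LinearMap.id)) (g := AddMonoidHom.id _) (hom_ext fun n c => ?_) t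
  change rid A (BTensor A N C) (map LinearMap.id (S.left c).toLinearMap
    (map (tmulRight C n) LinearMap.id ((Δ).left S.e))) = tmul A n c
  rw [← map_id_comm, rid_map]
  change tmul A n ((S.left c).act S.e) = _
  rw [act_eq, right_e, RightDual.act_one]

/-- The adjunction `- ⊗_A C ⊣ forget` of a Frobenius system. -/
def cofreeForgetAdj : cofreeFunctor A C ⊣ forgetToModule A C :=
  Adjunction.mkOfUnitCounit
    { unit :=
        { app := fun N => ModuleCat.ofHom (unitLinear S N)
          naturality := fun N N' f => rfl }
      counit :=
        { app := fun M => counitHom S M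
          naturality := fun M M' f => Hom.ext (ModuleCat.hom_ext (LinearMap.ext fun t =>
            counitLinear_natural S f t)) }
      left_triangle :=
        NatTrans.ext (funext fun N => Hom.ext (ModuleCat.hom_ext
          (LinearMap.ext fun t => counitLinear_map_unitLinear S N t)))
      right_triangle := by
        refine NatTrans.ext (funext fun M => ModuleCat.hom_ext (LinearMap.ext fun m => ?_))
        change rid A M.carrier (map LinearMap.id (S.left S.e).toLinearMap (M.coact m)) = m
        rw [left_e]
        exact M.coact_counit m }

end ToAdjunction

end FrobeniusSystem

theorem isFrobeniusCoring_iff_nonempty_frobeniusSystem (A C : Type u) [Ring A] [AddCommGroup C]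
    [Module A C] [Module Aᵐᵒᵖ C] [SMulCommClass A Aᵐᵒᵖ C] [Coring A C] :
    IsFrobeniusCoring A C ↔ Nonempty (FrobeniusSystem A C) := by
  constructor
  · rintro ⟨G, ⟨h⟩, ⟨h'⟩⟩
    -- Uniqueness of right adjoints identifies `G` with `- ⊗_A C`.
    exact ⟨FrobeniusSystem.ofAdjunction
      (h'.ofNatIsoLeft (h.rightAdjointUniq (RightComodule.forgetCofreeAdj A C)))⟩
  · rintro ⟨S⟩
    exact ⟨RightComodule.cofreeFunctor A C, ⟨RightComodule.forgetCofreeAdj A C⟩,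
      ⟨S.cofreeForgetAdj⟩⟩

/-- Finitely generated projective right modules are reflexive. -/
theorem isRightReflexive_of_finite_projective (A : Type u) (M : Type v) [Ring A]
    [AddCommGroup M] [Module Aᵐᵒᵖ M] [Module.Finite Aᵐᵒᵖ M] [Module.Projective Aᵐᵒᵖ M] :
    IsRightReflexive A M := by
  obtain ⟨n, f, g, -, -, hfg⟩ := Module.Finite.exists_comp_eq_id_of_projective Aᵐᵒᵖ M
  -- A dual basis `(b i, ξ i)`, from a splitting of a surjection from a free module of finite rank.
  let ξ : Fin n → M →ₗ[Aᵐᵒᵖ] A := fun i =>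
    (opLinearEquiv Aᵐᵒᵖ : A ≃ₗ[Aᵐᵒᵖ] Aᵐᵒᵖ).symm.toLinearMap ∘ₗ LinearMap.proj i ∘ₗ g
  let b : Fin n → M := fun i => f (Pi.single i 1)
  have hb : ∀ m, ∑ i, op (ξ i m) • b i = m := by
    intro m
    have h : f (g m) = m := LinearMap.congr_fun hfg m
    rw [LinearMap.pi_apply_eq_sum_univ f (g m)] at h
    refine Eq.trans (Finset.sum_congr rfl fun i _ => ?_) h
    change g m i • f (Pi.single i 1) = _
    congr 2
    ext j
    simp [Pi.single_apply, eq_comm]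
  constructor
  · intro m m' h
    rw [← hb m, ← hb m']
    refine Finset.sum_congr rfl fun i _ => ?_
    have h' : ξ i m = ξ i m' := LinearMap.congr_fun h (ξ i)
    rw [h']
  · intro G
    -- Since `η = ∑ η(b i) ξ i`, a left linear `G` is determined by its values on the `ξ i`.
    refine ⟨∑ i, op (G (ξ i)) • b i, LinearMap.ext fun η => ?_⟩
    change η (∑ i, op (G (ξ i)) • b i) = G η
    have hη : η = ∑ i, η (b i) • ξ i := LinearMap.ext fun m => by
      conv_lhs => rw [← hb m]
      simp
    conv_rhs => rw [hη]
    simp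

/-! ### The commuting actions of the two dual rings -/

section DualActions

open BTensor

variable {A : Type u} {C : Type v} [Ring A] [AddCommGroup C] [Module A C] [Module Aᵐᵒᵖ C]
  [SMulCommClass A Aᵐᵒᵖ C] [Coring A C]

local notation "Δ" => Coring.comul (A := A) (C := C)
local notation "ε" => Coring.counit (A := A) (C := C)

/-- Both sides are `ξ(c₍₁₎) ζ(c₍₂₎)`. -/
theorem LeftDual.apply_act_eq (ζ : LeftDual A C) (ξ : RightDual A C) (c : C) :
    ζ (ξ.act c) = ξ (ζ.act c) := by
  change ζ (ξ.contract ((Δ).left c)) = ξ (ζ.contract ((Δ).left c))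
  generalize (Δ).left c = t
  induction t using BTensor.induction_on with
  | h0 => simp
  | ht c d =>
    rw [RightDual.contract_tmul, LeftDual.contract_tmul, ζ.map_smul, ξ.map_op_smul]
  | ha x y hx hy => simp only [map_add, hx, hy]

/-- By coassociativity both sides are `ξ(c₍₁₎) c₍₂₎ ζ(c₍₃₎)`. -/
theorem LeftDual.act_comm (ζ : LeftDual A C) (ξ : RightDual A C) (c : C) :
    ζ.act (ξ.act c) = ξ.act (ζ.act c) := by
  have h₁ : ∀ t : BTensor A C C, ζ.act (ξ.contract t) =
      ζ.contract (lid A _ (map ξ.toLinearMap LinearMap.id (map LinearMap.id (Δ).left t))) := by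
    intro t
    induction t using BTensor.induction_on with
    | h0 => simp only [map_zero]
    | ht c d => exact congrArg ζ.contract ((Δ).left.map_smul (ξ c) d)
    | ha x y hx hy => simp only [map_add, hx, hy]
  have h₂ : ∀ t : BTensor A (BTensor A C C) C,
      ζ.contract (lid A _ (map ξ.toLinearMap LinearMap.id (assoc A C C C t))) =
      rid A C (map LinearMap.id ζ.toLinearMap (map ξ.contract LinearMap.id t)) := by
    intro t
    induction t using BTensor.induction_on with
    | h0 => simp only [map_zero]
    | ht s d =>
      induction s using BTensor.induction_on with
      | h0 => simp only [zero_tmul, map_zero]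
      | ht c c' => rfl
      | ha x y hx hy => simp only [add_tmul, map_add, hx, hy]
    | ha x y hx hy => simp only [map_add, hx, hy]
  refine (h₁ ((Δ).left c)).trans ?_
  rw [← Coring.coassoc, h₂, map_id_map, ← map_id_comm, rid_map]
  rfl

theorem RightDual.act_smul (ξ : RightDual A C) (a : A) (c : C) :
    ξ.act (op a • c) = op a • ξ.act c := ξ.act.map_smul (op a) c

theorem LeftDual.act_smul (ξ : LeftDual A C) (a : A) (c : C) :
    ξ.act (a • c) = a • ξ.act c := ξ.act.map_smul a c

theorem RightDual.iota_act (a : A) (c : C) : (RightDual.iota A C a).act c = a • c := by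
  have h : ∀ t : BTensor A C C, (RightDual.iota A C a).contract t =
      a • (1 : RightDual A C).contract t := by
    intro t
    induction t using BTensor.induction_on with
    | h0 => simp
    | ht c d => exact mul_smul a ((ε).left c) d
    | ha x y hx hy => simp only [map_add, hx, hy, smul_add]
  exact (h _).trans (congrArg (a • ·) (RightDual.act_one c))

theorem LeftDual.iota_act (a : A) (c : C) : (LeftDual.iota A C a).act c = op a • c := by
  have h : ∀ t : BTensor A C C, (LeftDual.iota A C a).contract t =
      op a • (1 : LeftDual A C).contract t := by
    intro t
    induction t using BTensor.induction_on with
    | h0 => simp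
    | ht c d => exact mul_smul (op a) (op ((ε).left d)) c
    | ha x y hx hy => simp only [map_add, hx, hy, smul_add]
  exact (h _).trans (congrArg (op a • ·) (LeftDual.act_one c))

theorem RightDual.mul_iota_apply (ξ : RightDual A C) (a : A) (c : C) :
    (ξ * RightDual.iota A C a) c = ξ (a • c) := by
  rw [RightDual.mul_apply, RightDual.iota_act]

theorem RightDual.iota_mul_apply (ξ : RightDual A C) (a : A) (c : C) :
    (RightDual.iota A C a * ξ) c = a * ξ c := by
  rw [RightDual.mul_apply]
  exact congrArg (a * ·) (RightDual.one_act ξ c)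

theorem LeftDual.mul_iota_apply (ξ : LeftDual A C) (a : A) (c : C) :
    (ξ * LeftDual.iota A C a) c = ξ c * a := by
  rw [LeftDual.mul_apply]
  exact congrArg (· * a) (LeftDual.one_act ξ c)

theorem LeftDual.iota_mul_apply (ξ : LeftDual A C) (a : A) (c : C) :
    (LeftDual.iota A C a * ξ) c = ξ (op a • c) := by
  rw [LeftDual.mul_apply, LeftDual.iota_act]

/-- The right `A`-module structure of `C^*` through `ι^*`. -/
instance RightDual.instRightModule : Module Aᵐᵒᵖ (RightDual A C) :=
  Module.compHom (RightDual A C) (RingHom.op (RightDual.iota A C))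

/-- The right `A`-module structure of `^*C` through `^*ι`. -/
instance LeftDual.instRightModule : Module Aᵐᵒᵖ (LeftDual A C) :=
  Module.compHom (LeftDual A C) (RingHom.op (LeftDual.iota A C))

end DualActions

namespace FrobeniusSystem

open BTensor

variable {A : Type u} {C : Type v} [Ring A] [AddCommGroup C] [Module A C] [Module Aᵐᵒᵖ C]
  [SMulCommClass A Aᵐᵒᵖ C] [Coring A C]

/-! ### Frobenius systems from a bijective orbit map -/

section Construction

variable (e : C) (smul_e : ∀ a : A, a • e = op a • e)

/-- A Frobenius system from a central element `e` for which `ξ ↦ ξ(e₍₁₎) e₍₂₎` is a bijection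
`C^* → C`. -/
noncomputable def ofRightDual (h : Function.Bijective fun ξ : RightDual A C => ξ.act e)
    (hr : Function.Injective (rightEval A C)) : FrobeniusSystem A C :=
  let φ : RightDual A C ≃ C := Equiv.ofBijective _ h
  have hφ : ∀ c, (φ.symm c).act e = c := φ.apply_symm_apply
  have hφ' : ∀ ξ : RightDual A C, φ.symm (ξ.act e) = ξ := φ.symm_apply_apply
  let left : C → LeftDual A C := fun d => LeftDual.ofLinearMap
    { toFun := fun c => φ.symm c d
      map_add' := fun c c' => by
        have : φ.symm (c + c') = φ.symm c + φ.symm c' :=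
          φ.injective ((φ.apply_symm_apply _).trans (by
            change _ = (φ.symm c + φ.symm c').act e
            rw [RightDual.add_act, hφ, hφ]))
        rw [this]
        rfl
      map_smul' := fun a c => by
        -- By `act_act` the orbit map `φ` is left `C^*`-linear, hence left `A`-linear through `ι^*`.
        have : φ.symm (a • c) = RightDual.iota A C a * φ.symm c :=
          φ.injective ((φ.apply_symm_apply _).trans (by
            change _ = (RightDual.iota A C a * φ.symm c).act e
            rw [← RightDual.act_act, hφ, RightDual.iota_act]))
        rw [this, RightDual.iota_mul_apply]
        rfl }
  { e := e
    right := φ.symm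
    left := left
    smul_e := smul_e
    left_apply := fun _ _ => rfl
    balanced := fun c a d => by
      -- Centrality of `e` makes `φ` right `A`-linear as well.
      have : φ.symm (op a • c) = φ.symm c * RightDual.iota A C a :=
        φ.injective ((φ.apply_symm_apply _).trans (by
          change _ = (φ.symm c * RightDual.iota A C a).act e
          rw [← RightDual.act_act, RightDual.iota_act, smul_e, RightDual.act_smul, hφ]))
      rw [this, RightDual.mul_iota_apply]
    act_eq := fun c d => by
      -- Every `η` in `C^*` takes the same value on both sides: `η((left d).act e) = (left d)(η.act
      -- e) = η(d)`. Writing `c` as a `C^*`-multiple of `e`, the commuting actions then reduce the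
      -- axiom to this case.
      have h₁ : (left d).act e = d := hr (LinearMap.ext fun η => by
        refine ((left d).apply_act_eq (RightDual.ofLinearMap η) e).symm.trans ?_
        exact DFunLike.congr_fun (hφ' (RightDual.ofLinearMap η)) d)
      rw [← hφ c, LeftDual.act_comm, h₁, hφ]
    right_e := by
      rw [← hφ' 1, RightDual.act_one]
    left_e := LeftDual.ext fun c => by
      refine (RightDual.one_act (φ.symm c) e).symm.trans ?_
      rw [hφ]
      rfl }

/-- A Frobenius system from a central element `e` for which `ξ ↦ e₍₁₎ ξ(e₍₂₎)` is a bijection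
`^*C → C`. -/
noncomputable def ofLeftDual (h : Function.Bijective fun ξ : LeftDual A C => ξ.act e)
    (hl : Function.Injective (leftEval A C)) : FrobeniusSystem A C :=
  let φ : LeftDual A C ≃ C := Equiv.ofBijective _ h
  have hφ : ∀ c, (φ.symm c).act e = c := φ.apply_symm_apply
  have hφ' : ∀ ξ : LeftDual A C, φ.symm (ξ.act e) = ξ := φ.symm_apply_apply
  let right : C → RightDual A C := fun c => RightDual.ofLinearMap
    { toFun := fun d => φ.symm d c
      map_add' := fun d d' => by
        have : φ.symm (d + d') = φ.symm d + φ.symm d' :=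
          φ.injective ((φ.apply_symm_apply _).trans (by
            change _ = (φ.symm d + φ.symm d').act e
            rw [LeftDual.add_act, hφ, hφ]))
        rw [this]
        rfl
      map_smul' := fun a d => by
        have : φ.symm (a • d) = φ.symm d * LeftDual.iota A C a.unop :=
          φ.injective ((φ.apply_symm_apply _).trans (by
            change _ = (φ.symm d * LeftDual.iota A C a.unop).act e
            rw [← LeftDual.act_act, hφ, LeftDual.iota_act]
            rfl))
        rw [this, LeftDual.mul_iota_apply]
        rfl }
  { e := e
    right := right
    left := φ.symm
    smul_e := smul_e
    left_apply := fun _ _ => rfl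
    balanced := fun c a d => by
      have : φ.symm (a • d) = LeftDual.iota A C a * φ.symm d :=
        φ.injective ((φ.apply_symm_apply _).trans (by
          change _ = (LeftDual.iota A C a * φ.symm d).act e
          rw [← LeftDual.act_act, LeftDual.iota_act, ← smul_e, LeftDual.act_smul, hφ]))
      change φ.symm d (op a • c) = φ.symm (a • d) c
      rw [this, LeftDual.iota_mul_apply]
    act_eq := fun c d => by
      -- The mirror image: forms in `^*C` separate points, and `d` is written as a `^*C`-multiple of
      -- `e`.
      have h₁ : (right c).act e = c := hl (LinearMap.ext fun η => by
        refine (LeftDual.apply_act_eq (LeftDual.ofLinearMap η) (right c) e).trans ?_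
        exact DFunLike.congr_fun (hφ' (LeftDual.ofLinearMap η)) c)
      conv_rhs => rw [← hφ d, ← LeftDual.act_comm, h₁]
    right_e := RightDual.ext fun c => by
      refine (LeftDual.one_act (φ.symm c) e).symm.trans ?_
      rw [hφ]
      rfl
    left_e := by
      rw [← hφ' 1, LeftDual.act_one] }

end Construction

/-! ### A Frobenius system identifies `C` with both of its duals -/

section DualEquivalences

variable (S : FrobeniusSystem A C)

theorem left_act_e (c : C) : (S.left c).act S.e = c := by
  rw [S.act_eq, S.right_e, RightDual.act_one]

theorem right_act_e (c : C) : (S.right c).act S.e = c := by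
  rw [← S.act_eq, S.left_e, LeftDual.act_one]

theorem right_act (ξ : RightDual A C) : S.right (ξ.act S.e) = ξ :=
  RightDual.ext fun c => by
    rw [← S.left_apply, LeftDual.apply_act_eq, S.left_act_e]

theorem left_act (ξ : LeftDual A C) : S.left (ξ.act S.e) = ξ :=
  LeftDual.ext fun c => by
    rw [S.left_apply, ← LeftDual.apply_act_eq, S.right_act_e]

/-- The isomorphism `ξ ↦ ξ(e₍₁₎) e₍₂₎` of right modules. -/
def rightDualEquiv : RightDual A C ≃ₗ[Aᵐᵒᵖ] C where
  toFun ξ := ξ.act S.e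
  map_add' ξ η := RightDual.add_act ξ η S.e
  map_smul' a ξ := by
    change (ξ * RightDual.iota A C a.unop).act S.e = op a.unop • ξ.act S.e
    rw [← RightDual.act_act, RightDual.iota_act, S.smul_e, RightDual.act_smul]
  invFun := S.right
  left_inv := S.right_act
  right_inv := S.right_act_e

/-- The isomorphism `ξ ↦ e₍₁₎ ξ(e₍₂₎)` of right modules. -/
def leftDualEquiv : LeftDual A C ≃ₗ[Aᵐᵒᵖ] C where
  toFun ξ := ξ.act S.e
  map_add' ξ η := LeftDual.add_act ξ η S.e
  map_smul' a ξ := by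
    change (ξ * LeftDual.iota A C a.unop).act S.e = op a.unop • ξ.act S.e
    rw [← LeftDual.act_act, LeftDual.iota_act]
  invFun := S.left
  left_inv := S.left_act
  right_inv := S.left_act_e

/-- For `t = ∑ bᵢ ⊗ dᵢ` the map `c ↦ ∑ bᵢ σ(dᵢ ⊗ c)` passes through a free module with one generator
for each summand. At `t = Δ(e)` this map is the identity of `C`, which is therefore a direct summand
of a finitely generated projective module. -/
theorem exists_factorization (t : BTensor A C C) :
    ∃ (F : Type u) (_ : AddCommGroup F) (_ : Module Aᵐᵒᵖ F), Module.Finite Aᵐᵒᵖ F ∧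
      Module.Projective Aᵐᵒᵖ F ∧ ∃ (f : C →ₗ[Aᵐᵒᵖ] F) (g : F →ₗ[Aᵐᵒᵖ] C),
        ∀ c, g (f c) = (S.left c).contract t := by
  induction t using BTensor.induction_on with
  | h0 => exact ⟨PUnit, inferInstance, inferInstance, inferInstance, inferInstance, 0, 0, by simp⟩
  | ht b d =>
    refine ⟨Aᵐᵒᵖ, inferInstance, inferInstance, inferInstance, inferInstance,
      (opLinearEquiv Aᵐᵒᵖ : A ≃ₗ[Aᵐᵒᵖ] Aᵐᵒᵖ).toLinearMap ∘ₗ (S.right d).toLinearMap,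
      LinearMap.toSpanSingleton Aᵐᵒᵖ C b, fun c => ?_⟩
    rw [LeftDual.contract_tmul, S.left_apply]
    rfl
  | ha x y hx hy =>
    obtain ⟨F, _, _, _, _, f, g, h⟩ := hx
    obtain ⟨F', _, _, _, _, f', g', h'⟩ := hy
    exact ⟨F × F', inferInstance, inferInstance, inferInstance, inferInstance,
      f.prod f', g.coprod g', fun c => by simp [h, h']⟩

end DualEquivalences

theorem finite_and_projective (S : FrobeniusSystem A C) :
    Module.Finite Aᵐᵒᵖ C ∧ Module.Projective Aᵐᵒᵖ C := by
  obtain ⟨F, _, _, _, _, f, g, h⟩ := S.exists_factorization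
    ((Coring.comul (A := A) (C := C)).left S.e)
  have h' : ∀ c, g (f c) = c := fun c => (h c).trans (S.left_act_e c)
  exact ⟨Module.Finite.of_surjective g fun c => ⟨f c, h' c⟩,
    Module.Projective.of_split f g (LinearMap.ext h')⟩

/-! ### Frobenius systems and Frobenius extensions -/

/-- The isomorphism sends `ξ` to `η ↦ (ξ η)(e) = ξ(η.act e)`. It is precomposition with `C^* ≅ C`,
hence bijective. -/
theorem isFrobeniusExtension_rightDual (S : FrobeniusSystem A C) :
    IsFrobeniusExtension (RightDual.iota A C) := by
  obtain ⟨_, _⟩ := S.finite_and_projective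
  refine ⟨Module.Finite.equiv S.rightDualEquiv.symm,
    Module.Projective.of_equiv S.rightDualEquiv.symm, ?_⟩
  let Φ : RightDual A C ≃+ (RightDual A C →ₗ[Aᵐᵒᵖ] A) :=
    { toFun := fun ξ => ξ.toLinearMap ∘ₗ S.rightDualEquiv.toLinearMap
      invFun := fun f => RightDual.ofLinearMap (f ∘ₗ S.rightDualEquiv.symm.toLinearMap)
      left_inv := fun ξ => RightDual.ext fun c => congrArg ξ (S.right_act_e c)
      right_inv := fun f => LinearMap.ext fun η => congrArg f (S.right_act η)
      map_add' := fun _ _ => rfl }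
  refine ⟨Φ, fun a x s y => ?_⟩
  change (RightDual.iota A C a * x * s * y) S.e = a * (x * (s * y)) S.e
  rw [mul_assoc, mul_assoc, RightDual.iota_mul_apply]

/-- The product of `^*C` is reversed, so here `(ξ η)(e) = η(ξ.act e)`. The map is `^*C ≅ C` followed
by evaluation into the double dual, which is bijective by left reflexivity. -/
theorem isFrobeniusExtension_leftDual (S : FrobeniusSystem A C) (hl : IsLeftReflexive A C) :
    IsFrobeniusExtension (LeftDual.iota A C) := by
  obtain ⟨_, _⟩ := S.finite_and_projective
  refine ⟨Module.Finite.equiv S.leftDualEquiv.symm,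
    Module.Projective.of_equiv S.leftDualEquiv.symm, ?_⟩
  let Ψ : LeftDual A C →+ (LeftDual A C →ₗ[Aᵐᵒᵖ] A) :=
    { toFun := fun ξ =>
        { toFun := fun η => η (ξ.act S.e)
          map_add' := fun _ _ => rfl
          map_smul' := fun a η => LeftDual.mul_iota_apply η a.unop (ξ.act S.e) }
      map_zero' := LinearMap.ext fun η => by
        have h : (0 : LeftDual A C).act S.e = 0 := map_zero S.leftDualEquiv
        change η ((0 : LeftDual A C).act S.e) = 0
        rw [h, map_zero]
      map_add' := fun ξ ξ' => LinearMap.ext fun η => by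
        change η ((ξ + ξ').act S.e) = η (ξ.act S.e) + η (ξ'.act S.e)
        rw [LeftDual.add_act, map_add] }
  have hΨ : Function.Bijective Ψ := by
    constructor
    · intro ξ ξ' h
      exact S.leftDualEquiv.injective (hl.1 (LinearMap.ext fun η =>
        LinearMap.congr_fun h (LeftDual.ofLinearMap η)))
    · intro f
      obtain ⟨c, hc⟩ := hl.2
        { toFun := fun η => f (LeftDual.ofLinearMap η)
          map_add' := fun η η' =>
            f.map_add (LeftDual.ofLinearMap η) (LeftDual.ofLinearMap η')
          map_smul' := fun a η => by
            refine Eq.trans (congrArg f ?_) (f.map_smul a (LeftDual.ofLinearMap η))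
            exact LeftDual.ext fun c =>
              (LeftDual.mul_iota_apply (LeftDual.ofLinearMap η) a.unop c).symm }
      refine ⟨S.left c, LinearMap.ext fun η => ?_⟩
      change η ((S.left c).act S.e) = f η
      rw [S.left_act_e]
      exact LinearMap.congr_fun hc η
  refine ⟨AddEquiv.ofBijective Ψ hΨ, fun a x s y => ?_⟩
  -- Centrality of `e` enters: `(^*ι(a) ζ)(e) = ζ(e a) = ζ(a e) = a ζ(e)`.
  change (LeftDual.iota A C a * x * s * y) S.e = a * (x * (s * y)) S.e
  rw [mul_assoc, mul_assoc, LeftDual.iota_mul_apply, ← S.smul_e, LeftDual.map_smul]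

/-- Right reflexivity writes `Φ 1` as evaluation at some `e`, so that `Φ ξ η = ξ(η.act e)`. The
orbit map sits in the argument of `ξ`, so its bijectivity follows from that of `Φ` by dualizing
back; this needs `C^*` to be reflexive, which finite projectivity supplies. -/
theorem nonempty_of_rightDual (hr : IsRightReflexive A C)
    (h : IsFrobeniusExtension (RightDual.iota A C)) : Nonempty (FrobeniusSystem A C) := by
  obtain ⟨hfin, hproj, Φ', hΦ'⟩ := h
  let Φ : RightDual A C ≃+ (RightDual A C →ₗ[Aᵐᵒᵖ] A) := Φ'
  have hΦ : ∀ (a : A) (x s y : RightDual A C),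
      Φ (RightDual.iota A C a * x * s) y = a * Φ x (s * y) := hΦ'
  have : Module.Finite Aᵐᵒᵖ (RightDual A C) := hfin
  have : Module.Projective Aᵐᵒᵖ (RightDual A C) := hproj
  have hdual := isRightReflexive_of_finite_projective A (RightDual A C)
  have hmul : ∀ ξ η, Φ ξ η = Φ 1 (ξ * η) := fun ξ η => by
    simpa using hΦ 1 1 ξ η
  have hleft : ∀ a η, Φ 1 (RightDual.iota A C a * η) = a * Φ 1 η := fun a η => by
    rw [← hmul]
    simpa using hΦ a 1 1 η
  obtain ⟨e, he⟩ := hr.2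
    { toFun := fun ξ => Φ 1 (RightDual.ofLinearMap ξ)
      map_add' := fun ξ η =>
        (Φ 1).map_add (RightDual.ofLinearMap ξ) (RightDual.ofLinearMap η)
      map_smul' := fun a ξ => by
        refine Eq.trans (congrArg (Φ 1) ?_) (hleft a (RightDual.ofLinearMap ξ))
        exact RightDual.ext fun c =>
          (RightDual.iota_mul_apply (RightDual.ofLinearMap ξ) a c).symm }
  have he : ∀ ξ : RightDual A C, ξ e = Φ 1 ξ := fun ξ => LinearMap.congr_fun he ξ.toLinearMap
  have hact : ∀ ξ η : RightDual A C, Φ ξ η = ξ (η.act e) := fun ξ η => by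
    rw [hmul, ← he, RightDual.mul_apply]
  -- Right linearity of `Φ 1` gives `ξ(a e) = ξ(e) a = ξ(e a)` for all `ξ`.
  have smul_e : ∀ a : A, a • e = op a • e := fun a => hr.1 (LinearMap.ext fun η => by
    let ξ : RightDual A C := RightDual.ofLinearMap η
    change ξ (a • e) = ξ (op a • e)
    rw [← RightDual.mul_iota_apply, he, RightDual.map_op_smul, he]
    exact (Φ 1).map_smul (op a) ξ)
  refine ⟨ofRightDual e smul_e ⟨fun η η' h => ?_, fun c => ?_⟩ hr.1⟩
  · refine hdual.1 (LinearMap.ext fun f => ?_)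
    obtain ⟨ξ, rfl⟩ := Φ.surjective f
    change Φ ξ η = Φ ξ η'
    rw [hact, hact]
    exact congrArg ξ h
  -- The preimage of `c` is the `η` at which evaluation is the form `f ↦ (Φ.symm f) c` on the dual
  -- of `C^*`. At `f = Φ ζ` this says `ζ(η.act e) = ζ(c)`.
  · obtain ⟨η, hη⟩ := hdual.2
      { toFun := fun f => Φ.symm f c
        map_add' := fun f g => by
          rw [map_add]
          rfl
        map_smul' := fun a f => by
          have h : Φ.symm (a • f) = RightDual.iota A C a * Φ.symm f :=
            Φ.symm_apply_eq.2 (LinearMap.ext fun y => by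
              have := hΦ a (Φ.symm f) 1 y
              rw [mul_one, one_mul, Φ.apply_symm_apply] at this
              exact this.symm)
          rw [h, RightDual.iota_mul_apply]
          rfl }
    refine ⟨η, hr.1 (LinearMap.ext fun ζ => ?_)⟩
    have h := LinearMap.congr_fun hη (Φ (RightDual.ofLinearMap ζ))
    change Φ (RightDual.ofLinearMap ζ) η = Φ.symm (Φ (RightDual.ofLinearMap ζ)) c at h
    rw [hact, Φ.symm_apply_apply] at h
    exact h

/-- Here `Φ ξ η = η(ξ.act e)`, so `Φ` is already the orbit map followed by evaluation. Injectivity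
of the orbit map is that of `Φ`, and the preimage of `c` is the element that `Φ` sends to evaluation
at `c`. -/
theorem nonempty_of_leftDual (hl : IsLeftReflexive A C)
    (h : IsFrobeniusExtension (LeftDual.iota A C)) : Nonempty (FrobeniusSystem A C) := by
  obtain ⟨-, -, Φ', hΦ'⟩ := h
  let Φ : LeftDual A C ≃+ (LeftDual A C →ₗ[Aᵐᵒᵖ] A) := Φ'
  have hΦ : ∀ (a : A) (x s y : LeftDual A C),
      Φ (LeftDual.iota A C a * x * s) y = a * Φ x (s * y) := hΦ'
  have hmul : ∀ ξ η, Φ ξ η = Φ 1 (ξ * η) := fun ξ η => by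
    simpa using hΦ 1 1 ξ η
  have hleft : ∀ a η, Φ 1 (LeftDual.iota A C a * η) = a * Φ 1 η := fun a η => by
    rw [← hmul]
    simpa using hΦ a 1 1 η
  have hsmul : ∀ (a : Aᵐᵒᵖ) (η : C →ₗ[A] A),
      LeftDual.ofLinearMap (a • η) = a • LeftDual.ofLinearMap η := fun a η =>
    LeftDual.ext fun c => (LeftDual.mul_iota_apply (LeftDual.ofLinearMap η) a.unop c).symm
  obtain ⟨e, he⟩ := hl.2
    { toFun := fun ξ => Φ 1 (LeftDual.ofLinearMap ξ)
      map_add' := fun ξ η =>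
        (Φ 1).map_add (LeftDual.ofLinearMap ξ) (LeftDual.ofLinearMap η)
      map_smul' := fun a ξ => by rw [hsmul, map_smul]; rfl }
  have he : ∀ ξ : LeftDual A C, ξ e = Φ 1 ξ := fun ξ => LinearMap.congr_fun he ξ.toLinearMap
  have hact : ∀ ξ η : LeftDual A C, Φ ξ η = η (ξ.act e) := fun ξ η => by
    rw [hmul, ← he, LeftDual.mul_apply]
  have smul_e : ∀ a : A, a • e = op a • e := fun a => hl.1 (LinearMap.ext fun η => by
    let ξ : LeftDual A C := LeftDual.ofLinearMap η
    change ξ (a • e) = ξ (op a • e)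
    rw [← LeftDual.iota_mul_apply, he, LeftDual.map_smul, he, hleft])
  refine ⟨ofLeftDual e smul_e ⟨fun ξ ξ' h => ?_, fun c => ?_⟩ hl.1⟩
  · refine Φ.injective (LinearMap.ext fun η => ?_)
    rw [hact, hact]
    exact congrArg η h
  · let f : LeftDual A C →ₗ[Aᵐᵒᵖ] A :=
      { toFun := fun η => η c
        map_add' := fun _ _ => rfl
        map_smul' := fun a η => LeftDual.mul_iota_apply η a.unop c }
    refine ⟨Φ.symm f, hl.1 (LinearMap.ext fun ζ => ?_)⟩
    have h := hact (Φ.symm f) (LeftDual.ofLinearMap ζ)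
    rw [Φ.apply_symm_apply] at h
    exact h.symm

end FrobeniusSystem

theorem mainTheorem9 (A C : Type u) [Ring A] [AddCommGroup C] [Module A C] [Module Aᵐᵒᵖ C]
    [SMulCommClass A Aᵐᵒᵖ C] [Coring A C]
    (hl : IsLeftReflexive A C) (hr : IsRightReflexive A C) :
    List.TFAE
      [IsFrobeniusCoring A C,
        IsFrobeniusExtension (LeftDual.iota A C),
        IsFrobeniusExtension (RightDual.iota A C)] := by
  rw [isFrobeniusCoring_iff_nonempty_frobeniusSystem]
  tfae_have 1 → 2 := fun ⟨S⟩ => S.isFrobeniusExtension_leftDual hl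
  tfae_have 1 → 3 := fun ⟨S⟩ => S.isFrobeniusExtension_rightDual
  tfae_have 2 → 1 := FrobeniusSystem.nonempty_of_leftDual hl
  tfae_have 3 → 1 := FrobeniusSystem.nonempty_of_rightDual hr
  tfae_finish
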